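/- All polytopes are nonempty convex hulls of finitely many points of some $\mathbb R^q$; two polytopes are combinatorially equivalent if their face lattices are isomorphic, and affinely isomorphic if an affine map of the ambient spaces restricts to a bijection between them. Let $P$ be an $n$-polytope. A special $m$-simplex of $P$ is a simplex $\Sigma$ spanned by $m+1$ affinely independent vertices of $P$ such that every facet of $P$ contains all but exactly one vertex of $\Sigma$. The basis polytope of $(P,\Sigma)$ is the image $\pi(P)$ under a surjective linear map $\pi$ whose kernel is the linear space parallel to the affine hull of $\Sigma$ (it is determined up to affine isomorphism). $P$ is meek with respect to $\Sigma$ if the affine hull of the union of all faces of $P$ that contain no vertex of $\Sigma$ has the same dimension as the basis polytope. For polytopes $S\subset\mathbb R^a$ and $Q\subset\mathbb R^b$, translated so that the origin is a relative interior point of each, the direct sum is $$S\oplus Q=\{(\lambda_1 v,\lambda_2 w)\in\mathbb R^{a+b} : v\in S,\ w\in Q,\ \lambda_1,\lambda_2\ge 0,\ \lambda_1+\lambda_2\le 1\},$$ and $\operatorname{pyr}K\subset\mathbb R^{d+1}$ is the convex hull of $K\times\{0\}$ and $(0,\dots,0,1)$ for $K\subset\mathbb R^d$; $\operatorname{pyr}^i$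 is its $i$-fold iterate. "$\operatorname{pyr}^i(\Sigma_j\oplus Q)$" below means such a polytope for some $j$-simplex $\Sigma_j\subset\mathbb R^j$ and some choice of the translations. Theorem. Let $1\le m<n$. 1. An $n$-polytope $P$ is meek with respect to some special $m$-simplex if and only if there are an $(n-m)$-polytope $Q$ and integers $i\ge 0$, $j>0$ with $i+j=m$ such that $P$ is affinely isomorphic to $\operatorname{pyr}^i(\Sigma_j\oplus Q)$. 2. In this statement $Q$ is the basis polytope: for an $n$-polytope $P$ and a polytope $Q$, $P$ is meek with respect to some special $m$-simplex whose basis polytope is affinely isomorphic to $Q$ if and only if $\dim Q=n-m$ and $P$ is affinely isomorphic to $\operatorname{pyr}^i(\Sigma_j\oplus Q)$ for some $i\ge0$, $j>0$ with $i+j=m$. 3. Combinatorially: let $Q$ be an $(n-m)$-polytope and $P$ an $n$-polytope. Then $P$ is combinatorially equivalent to an $n$-polytope that is meek with respect to a special $m$-simplex with basis polytope combinatorially equivalent to $Q$ if and only if $P$ is combinatorially equivalent to $\operatorname{pyr}^i(\Sigma_j\oplus Q)$ for some $i\ge0$, $j>0$ with $i+j=m$. 4. For every $(n-m)$-polytope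 $Q$ there are exactly $m$ combinatorial types of $n$-polytopes that are meek with respect to a special $m$-simplex with basis polytope combinatorially equivalent to $Q$. -/

import Mathlib

noncomputable section

namespace SpecialSimplex

/-- A (nonempty) convex polytope: the convex hull of finitely many points. -/
def IsPolytope {q : ℕ} (P : Set (Fin q → ℝ)) : Prop :=
  ∃ t : Finset (Fin q → ℝ), t.Nonempty ∧ P = convexHull ℝ (t : Set (Fin q → ℝ))

/-- The dimension of (the affine hull of) a nonempty set. -/
def dim {q : ℕ} (P : Set (Fin q → ℝ)) : ℕ :=
  Module.finrank ℝ (vectorSpan ℝ P)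

/-- The face lattice of `P`, ordered by inclusion. `IsExposed` allows `∅` and `P` itself. -/
abbrev FaceLattice {q : ℕ} (P : Set (Fin q → ℝ)) : Type :=
  {F : Set (Fin q → ℝ) // IsExposed ℝ P F}

/-- Combinatorial equivalence: isomorphic face lattices. -/
def CombEquiv {q r : ℕ} (P : Set (Fin q → ℝ)) (R : Set (Fin r → ℝ)) : Prop :=
  Nonempty (FaceLattice P ≃o FaceLattice R)

/-- Affine isomorphism of polytopes: an affine map between the ambient spaces that restricts
to a bijection between the two polytopes. -/
def AffEquiv {q r : ℕ} (P : Set (Fin q → ℝ)) (R : Set (Fin r → ℝ)) : Prop :=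
  ∃ f : (Fin q → ℝ) →ᵃ[ℝ] (Fin r → ℝ), Set.BijOn f P R

/-- A facet: a nonempty face of codimension one. -/
def IsFacet {q : ℕ} (P F : Set (Fin q → ℝ)) : Prop :=
  IsExposed ℝ P F ∧ F.Nonempty ∧ dim F + 1 = dim P

/-- `s` is the vertex set of a special `m`-simplex of `P`: it consists of `m + 1` affinely
independent vertices of `P`, and every facet of `P` contains all but exactly one of them. -/
def IsSpecialSimplex {q : ℕ} (m : ℕ) (P : Set (Fin q → ℝ)) (s : Finset (Fin q → ℝ)) : Prop :=
  s.card = m + 1 ∧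
  (s : Set (Fin q → ℝ)) ⊆ P.extremePoints ℝ ∧
  AffineIndependent ℝ (fun x : s => (x : Fin q → ℝ)) ∧
  ∀ F, IsFacet P F → ∃! x, x ∈ s ∧ x ∉ F

/-- `Q` is the basis polytope of `P` with respect to the simplex with vertex set `s`: the image
of `P` under a projection whose kernel is the linear space parallel to the affine hull of `s`. -/
def IsBasisPolytope {q d : ℕ} (P : Set (Fin q → ℝ)) (s : Finset (Fin q → ℝ))
    (Q : Set (Fin d → ℝ)) : Prop :=
  ∃ π : (Fin q → ℝ) →ₗ[ℝ] (Fin d → ℝ), Function.Surjective π ∧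
    LinearMap.ker π = vectorSpan ℝ (s : Set (Fin q → ℝ)) ∧ π '' P = Q

/-- The union of the faces of `P` that contain no element of `s`. -/
def restComplexSupport {q : ℕ} (P : Set (Fin q → ℝ)) (s : Finset (Fin q → ℝ)) :
    Set (Fin q → ℝ) :=
  ⋃₀ {F | IsExposed ℝ P F ∧ Disjoint F (s : Set (Fin q → ℝ))}

/-- `P` is meek with respect to `s`: the complex of the faces of `P` without vertices in `s`
has an affine hull of the same dimension as the basis polytope. -/
def IsMeek {q : ℕ} (P : Set (Fin q → ℝ)) (s : Finset (Fin q → ℝ)) : Prop :=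
  ∃ (d : ℕ) (Q : Set (Fin d → ℝ)), IsBasisPolytope P s Q ∧
    dim Q = dim (restComplexSupport P s)

/-- The direct sum of `S ⊆ ℝᵃ` and `Q ⊆ ℝᵇ` in `ℝᵃ⁺ᵇ`. -/
def directSum {a b : ℕ} (S : Set (Fin a → ℝ)) (Q : Set (Fin b → ℝ)) :
    Set (Fin (a + b) → ℝ) :=
  {x | ∃ v ∈ S, ∃ w ∈ Q, ∃ l₁ l₂ : ℝ, 0 ≤ l₁ ∧ 0 ≤ l₂ ∧ l₁ + l₂ ≤ 1 ∧
    x = Fin.append (l₁ • v) (l₂ • w)}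

/-- The pyramid over `K ⊆ ℝᵈ` with apex `(0, …, 0, 1)`. -/
def pyr {d : ℕ} (K : Set (Fin d → ℝ)) : Set (Fin (d + 1) → ℝ) :=
  convexHull ℝ (insert (Fin.snoc (α := fun _ => ℝ) (0 : Fin d → ℝ) 1)
    ((fun x : Fin d → ℝ => Fin.snoc (α := fun _ => ℝ) x 0) '' K))

/-- The `i`-fold pyramid. -/
def pyrIter {d : ℕ} (K : Set (Fin d → ℝ)) : (i : ℕ) → Set (Fin (d + i) → ℝ)
  | 0 => K
  | i + 1 => pyr (pyrIter K i)

/-- A `j`-dimensional simplex in `ℝʲ`. -/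
def IsSimplex {j : ℕ} (S : Set (Fin j → ℝ)) : Prop :=
  ∃ v : Fin (j + 1) → (Fin j → ℝ), AffineIndependent ℝ v ∧ S = convexHull ℝ (Set.range v)

/-- `R` is an `i`-fold pyramid over a direct sum of a `j`-simplex `S` and `Q`. As usual for
direct sums, both summands are first translated so that the origin is a (relative) interior
point of each of them. -/
def IsPyramidOverSum (i j : ℕ) {d : ℕ} (Q : Set (Fin d → ℝ))
    (R : Set (Fin (j + d + i) → ℝ)) : Prop :=
  ∃ (S : Set (Fin j → ℝ)) (b : Fin j → ℝ) (c : Fin d → ℝ),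
    IsSimplex S ∧ b ∈ intrinsicInterior ℝ S ∧ c ∈ intrinsicInterior ℝ Q ∧
    R = pyrIter (directSum ((fun x => x - b) '' S) ((fun x => x - c) '' Q)) i

/-- `P` is a meek `n`-polytope with a special `m`-simplex whose basis polytope is, up to
combinatorial equivalence, `Q`. -/
def IsMeekOver {d q : ℕ} (n m : ℕ) (Q : Set (Fin d → ℝ)) (P : Set (Fin q → ℝ)) : Prop :=
  IsPolytope P ∧ dim P = n ∧ ∃ s, IsSpecialSimplex m P s ∧ IsMeek P s ∧
    ∃ (e : ℕ) (B : Set (Fin e → ℝ)), IsBasisPolytope P s B ∧ CombEquiv B Q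

end SpecialSimplex

end

/-! Everything passes through one normal form, `SplitHull`: P is the convex hull of affinely
independent points v k and a polytope C in a complementary direction, meeting in p = ∑ lam k • v k,
where p is a relative interior point of C and 0 ≤ lam k < 1.

Meek polytopes are split hulls (`IsSpecialSimplex.exists_splitHull`). Every proper face lies in a
facet, and every facet misses a vertex of Σ, so a nonpositive affine function vanishing on Σ
vanishes on P. Hence a functional constant on Σ but not on P attains both extremes over P at
vertices outside Σ. So the directions of Σ and of the set A of remaining vertices together span
those of P. Meekness bounds dim A by the dimension of the basis polytope, which forces the two
direction spaces to be independent. Thus aff Σ and aff A meet in one point p, and C = conv A. The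
same vanishing principle puts p in the relative interior of C; the facets missing one vertex of Σ
give nonnegative weights.

Conversely, a split hull is special and meek with respect to the v k, because compatible affine data
on the v k and on C always extend. Projecting along Σ identifies C with the basis polytope.

Points of weight 0 are pyramid apexes; the j + 1 points of positive weight span a simplex forming a
direct sum with C at p. As each weight is below 1, at least two are positive, so j > 0. This gives
the affine classification.

Faces of a split hull correspond to pairs (index set, face of C) where the index set contains all
positive-weight indices exactly when the face is C. So the combinatorial type depends only on that
of C and on the support of lam. With N proper faces of C (the empty one included) there are 2^(m+1)
N - 2^i (N - 1) faces in all; since N ≥ 2, this determines i, and i = 0, …, m - 1 gives m types. -/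

namespace SpecialSimplex

open Set

/-! ### Affine functions on convex hulls and on vector spans -/

section Affine

variable {V W : Type*} [AddCommGroup V] [Module ℝ V] [AddCommGroup W] [Module ℝ W]

theorem affineMap_sum {ι : Type*} [Fintype ι] (g : V →ᵃ[ℝ] W) (v : ι → V) {lam : ι → ℝ}
    (h : ∑ k, lam k = 1) : g (∑ k, lam k • v k) = ∑ k, lam k • g (v k) := by
  have hg : ∀ x, g x = g.linear x + g 0 := fun x => congrFun g.decomp x
  rw [hg, map_sum]
  simp_rw [hg (v _), smul_add, Finset.sum_add_distrib, ← Finset.sum_smul, h, one_smul, map_smul]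

theorem affineMap_le_on_convexHull {T : Set V} (f : V →ᵃ[ℝ] ℝ) {c : ℝ} (h : ∀ x ∈ T, f x ≤ c) :
    ∀ x ∈ convexHull ℝ T, f x ≤ c := by
  have : convexHull ℝ T ⊆ f ⁻¹' (Iic c) :=
    convexHull_min (fun x hx => h x hx) ((convex_Iic c).affine_preimage f)
  exact fun x hx => this hx

theorem affineMap_eqOn_convexHull {T : Set V} {f g : V →ᵃ[ℝ] W} (h : ∀ x ∈ T, f x = g x) :
    ∀ x ∈ convexHull ℝ T, f x = g x := by
  have : convexHull ℝ T ⊆ (f - g) ⁻¹' {0} :=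
    convexHull_min (fun x hx => by simp [h x hx])
      ((convex_singleton (0 : W)).affine_preimage (f - g))
  exact fun x hx => sub_eq_zero.mp (this hx)

/-- The points of a convex hull where a nonpositive affine function vanishes. -/
theorem zeros_convexHull {T : Set V} (f : V →ᵃ[ℝ] ℝ) (h : ∀ x ∈ T, f x ≤ 0) :
    {x ∈ convexHull ℝ T | f x = 0} = convexHull ℝ {x ∈ T | f x = 0} := by
  apply Subset.antisymm
  · rintro x ⟨hx, hfx⟩
    rw [_root_.convexHull_eq] at hx
    obtain ⟨ι, t, w, z, hw, hs, hz, rfl⟩ := hx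
    rw [Finset.centerMass_eq_of_sum_1 _ _ hs] at hfx ⊢
    have hf : f (∑ i ∈ t, w i • z i) = ∑ i ∈ t, w i * f (z i) := by
      have hg : ∀ x, f x = f.linear x + f 0 := fun x => congrFun f.decomp x
      rw [hg, map_sum]
      simp_rw [hg (z _), mul_add, Finset.sum_add_distrib, ← Finset.sum_mul, hs, one_mul, map_smul,
        smul_eq_mul]
    rw [hf] at hfx
    have h0 := (Finset.sum_eq_zero_iff_of_nonpos (fun i hi =>
      mul_nonpos_of_nonneg_of_nonpos (hw i hi) (h _ (hz i hi)))).mp hfx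
    rw [← Finset.sum_filter_of_ne (p := fun i => w i ≠ 0)
      (fun i _ hne hw0 => hne (by rw [hw0, zero_smul]))]
    refine (convex_convexHull ℝ _).sum_mem (fun i hi => hw i (Finset.mem_filter.mp hi).1) ?_ ?_
    · rw [Finset.sum_filter_ne_zero, hs]
    · intro i hi
      rw [Finset.mem_filter] at hi
      exact subset_convexHull ℝ _ ⟨hz i hi.1, (mul_eq_zero.mp (h0 i hi.1)).resolve_left hi.2⟩
  · intro x hx
    refine ⟨convexHull_mono (fun y hy => hy.1) hx, ?_⟩
    exact affineMap_eqOn_convexHull (f := f) (g := AffineMap.const ℝ V 0) (fun y hy => hy.2) x hx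

theorem vectorSpan_le_iff {A : Set V} {U : Submodule ℝ V} :
    vectorSpan ℝ A ≤ U ↔ ∀ x ∈ A, ∀ y ∈ A, x - y ∈ U := by
  rw [vectorSpan, Submodule.span_le]
  constructor
  · intro h x hx y hy
    exact h (vsub_mem_vsub hx hy)
  · rintro h _ ⟨x, hx, y, hy, rfl⟩
    exact h x hx y hy

/-- Containment of vector spans is detected by linear functionals. -/
theorem vectorSpan_le_vectorSpan_of_forall {A B : Set V}
    (h : ∀ l : V →ₗ[ℝ] ℝ, (∀ x ∈ B, ∀ y ∈ B, l x = l y) → ∀ x ∈ A, ∀ y ∈ A, l x = l y) :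
    vectorSpan ℝ A ≤ vectorSpan ℝ B := by
  rw [vectorSpan_le_iff]
  intro x hx y hy
  by_contra hn
  obtain ⟨l, hl, hle⟩ := Submodule.exists_le_ker_of_notMem hn
  refine hl ?_
  rw [map_sub, sub_eq_zero]
  refine h l (fun a ha b hb => ?_) x hx y hy
  have := hle (vsub_mem_vectorSpan ℝ ha hb)
  rwa [LinearMap.mem_ker, vsub_eq_sub, map_sub, sub_eq_zero] at this

theorem linear_eq_of_mem_vectorSpan {A : Set V} {f g : V →ᵃ[ℝ] W} (h : ∀ x ∈ A, f x = g x)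
    {u : V} (hu : u ∈ vectorSpan ℝ A) : f.linear u = g.linear u := by
  have : vectorSpan ℝ A ≤ LinearMap.ker (f.linear - g.linear) := by
    rw [vectorSpan_le_iff]
    intro x hx y hy
    have h1 := f.linearMap_vsub x y
    have h2 := g.linearMap_vsub x y
    simp only [vsub_eq_sub] at h1 h2
    rw [LinearMap.mem_ker, LinearMap.sub_apply, h1, h2, h x hx, h y hy, sub_self]
  exact sub_eq_zero.mp (this hu)

theorem linear_eq_zero_of_mem_vectorSpan {A : Set V} {f : V →ᵃ[ℝ] W} {c : W}
    (h : ∀ x ∈ A, f x = c) {u : V} (hu : u ∈ vectorSpan ℝ A) : f.linear u = 0 := by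
  have := linear_eq_of_mem_vectorSpan (f := f) (g := AffineMap.const ℝ V c) h hu
  simpa using this

theorem finrank_map_of_forall {U : Submodule ℝ V} {L : V →ₗ[ℝ] W}
    (h : ∀ u ∈ U, L u = 0 → u = 0) : Module.finrank ℝ (U.map L) = Module.finrank ℝ U := by
  have hinj : Function.Injective (L ∘ₗ U.subtype) := by
    rw [← LinearMap.ker_eq_bot, LinearMap.ker_eq_bot']
    exact fun u hu => Subtype.ext (h u u.2 hu)
  rw [← LinearMap.finrank_range_of_inj hinj, LinearMap.range_comp, Submodule.range_subtype]

end Affine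

/-! ### Faces as zero sets of nonpositive affine functions -/

section Faces

variable {q : ℕ} {P F : Set (Fin q → ℝ)}

theorem isExposed_zeros {f : (Fin q → ℝ) →ᵃ[ℝ] ℝ} (h : ∀ x ∈ P, f x ≤ 0) :
    IsExposed ℝ P {x ∈ P | f x = 0} := by
  rintro ⟨z, hz, hfz⟩
  have hg : ∀ x, f x = f.linear x + f 0 := fun x => congrFun f.decomp x
  refine ⟨LinearMap.toContinuousLinearMap f.linear, ?_⟩
  ext x
  simp only [mem_ofPred_eq, LinearMap.coe_toContinuousLinearMap']
  refine and_congr_right fun hx => ⟨fun h0 y hy => ?_, fun h1 => ?_⟩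
  · have := h y hy
    rw [hg] at this h0
    linarith
  · have := h1 z hz
    have h2 := h x hx
    rw [hg] at hfz h2 ⊢
    linarith

theorem exists_affineMap_of_isExposed (h : IsExposed ℝ P F) :
    ∃ f : (Fin q → ℝ) →ᵃ[ℝ] ℝ, (∀ x ∈ P, f x ≤ 0) ∧ F = {x ∈ P | f x = 0} := by
  rcases F.eq_empty_or_nonempty with rfl | hne
  -- The empty face is the zero set of a negative constant.
  · refine ⟨AffineMap.const ℝ _ (-1), fun x _ => by simp, ?_⟩
    ext x
    simp
  · obtain ⟨l, hl⟩ := h hne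
    obtain ⟨z, hz⟩ := hne
    have hz' := hz
    rw [hl] at hz'
    refine ⟨(l : (Fin q → ℝ) →ₗ[ℝ] ℝ).toAffineMap - AffineMap.const ℝ _ (l z), fun x hx => ?_, ?_⟩
    · simpa using hz'.2 x hx
    · rw [hl]
      ext x
      simp only [mem_ofPred_eq, AffineMap.coe_sub, Pi.sub_apply, LinearMap.coe_toAffineMap,
        ContinuousLinearMap.coe_coe, AffineMap.const_apply, sub_eq_zero]
      refine and_congr_right fun hx => ⟨fun h1 => le_antisymm (hz'.2 x hx) (h1 z hz'.1), ?_⟩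
      intro h1 y hy
      rw [h1]
      exact hz'.2 y hy

theorem IsPolytope.convex (h : IsPolytope P) : Convex ℝ P := by
  obtain ⟨t, -, rfl⟩ := h
  exact convex_convexHull ℝ _

theorem IsPolytope.nonempty (h : IsPolytope P) : P.Nonempty := by
  obtain ⟨t, ht, rfl⟩ := h
  exact (Finset.coe_nonempty.mpr ht).convexHull

theorem IsPolytope.isCompact (h : IsPolytope P) : IsCompact P := by
  obtain ⟨t, -, rfl⟩ := h
  exact t.finite_toSet.isCompact_convexHull ℝ

theorem IsPolytope.image {r : ℕ} (h : IsPolytope P) (f : (Fin q → ℝ) →ᵃ[ℝ] (Fin r → ℝ)) :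
    IsPolytope (f '' P) := by
  classical
  obtain ⟨t, ht, rfl⟩ := h
  exact ⟨t.image f, ht.image f, by rw [AffineMap.image_convexHull, Finset.coe_image]⟩

theorem IsPolytope.exists_isMaxOn (h : IsPolytope P) (f : (Fin q → ℝ) →ᵃ[ℝ] ℝ) :
    ∃ x ∈ P, ∀ y ∈ P, f y ≤ f x := by
  obtain ⟨x, hx, hm⟩ := h.isCompact.exists_isMaxOn h.nonempty
    (f.continuous_of_finiteDimensional).continuousOn
  exact ⟨x, hx, hm⟩

end Faces

/-! ### Relative interior points tested by affine functions -/

section RelativeInterior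

variable {q : ℕ} {C : Set (Fin q → ℝ)}

theorem exists_lineMap_mem_of_mem_intrinsicInterior {p z : Fin q → ℝ}
    (hp : p ∈ intrinsicInterior ℝ C) (hz : z ∈ affineSpan ℝ C) :
    ∃ ε : ℝ, 0 < ε ∧ AffineMap.lineMap p z ε ∈ C := by
  rw [mem_intrinsicInterior] at hp
  obtain ⟨y, hy, rfl⟩ := hp
  let φ : ℝ → affineSpan ℝ C := fun t => ⟨AffineMap.lineMap (y : Fin q → ℝ) z t,
    AffineMap.lineMap_mem t y.2 hz⟩
  have hφ : Continuous φ := by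
    refine Continuous.subtype_mk ?_ _
    exact AffineMap.lineMap_continuous
  have hφ0 : φ 0 = y := by
    apply Subtype.ext
    simp [φ]
  have h0 : φ ⁻¹' interior ((↑) ⁻¹' C : Set (affineSpan ℝ C)) ∈ nhds (0 : ℝ) :=
    hφ.continuousAt.preimage_mem_nhds (by rw [hφ0]; exact isOpen_interior.mem_nhds hy)
  obtain ⟨ε, hε, hb⟩ := Metric.mem_nhds_iff.mp h0
  refine ⟨ε / 2, by positivity, ?_⟩
  have : (ε / 2) ∈ Metric.ball (0 : ℝ) ε := by
    rw [Metric.mem_ball, Real.dist_eq, sub_zero, abs_of_pos (by positivity)]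
    linarith
  have h1 : φ (ε / 2) ∈ ((↑) ⁻¹' C : Set (affineSpan ℝ C)) := interior_subset (hb this)
  exact h1

theorem eq_of_le_of_mem_intrinsicInterior {p : Fin q → ℝ} (hp : p ∈ intrinsicInterior ℝ C)
    {g : (Fin q → ℝ) →ᵃ[ℝ] ℝ} (hg : ∀ x ∈ C, g x ≤ g p) : ∀ x ∈ C, g x = g p := by
  intro x hx
  have hpC := intrinsicInterior_subset hp
  -- Prolong the segment from x to p slightly beyond p: if g were smaller at x than at p, it would
  -- exceed g p there.
  obtain ⟨ε, hε, hm⟩ := exists_lineMap_mem_of_mem_intrinsicInterior hp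
    (AffineMap.lineMap_mem (-1 : ℝ) (subset_affineSpan ℝ C hpC) (subset_affineSpan ℝ C hx))
  have h1 := hg _ hm
  rw [AffineMap.apply_lineMap, AffineMap.apply_lineMap, AffineMap.lineMap_apply_ring',
    AffineMap.lineMap_apply_ring'] at h1
  have h2 : 0 ≤ ε * (g x - g p) := by linarith
  have h3 := nonneg_of_mul_nonneg_right h2 hε
  exact le_antisymm (hg x hx) (by linarith)

/-- Hahn–Banach inside the affine hull: were p not relatively interior, a functional would be
strictly smaller on the relative interior than at p, hence at most its value at p on all of C,
contradicting the hypothesis. -/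
theorem mem_intrinsicInterior_of_forall (hC : Convex ℝ C) {p : Fin q → ℝ}
    (hp : p ∈ affineSpan ℝ C)
    (h : ∀ g : (Fin q → ℝ) →ᵃ[ℝ] ℝ, (∀ x ∈ C, g x ≤ g p) → ∀ x ∈ C, g x = g p) :
    p ∈ intrinsicInterior ℝ C := by
  by_contra hn
  have hne : C.Nonempty := by
    rw [← affineSpan_nonempty ℝ]
    exact ⟨p, hp⟩
  have hin := hne.intrinsicInterior hC
  let D := (affineSpan ℝ C).direction
  have : Nonempty (affineSpan ℝ C) := ⟨⟨p, hp⟩⟩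
  -- Base the affine hull at p, so that separation takes place in the normed space D with p as
  -- origin.
  let φ : D ≃ₜ affineSpan ℝ C :=
    (ContinuousAffineEquiv.vaddConst ℝ (⟨p, hp⟩ : affineSpan ℝ C)).toHomeomorph
  have hφ : ∀ u : D, ((φ u : affineSpan ℝ C) : Fin q → ℝ) = (u : Fin q → ℝ) + p := fun u => rfl
  let C₀ : Set D := φ ⁻¹' ((↑) ⁻¹' C)
  have hC₀ : ∀ u : D, u ∈ C₀ ↔ (u : Fin q → ℝ) + p ∈ C := fun u => by
    simp only [C₀, mem_preimage, hφ]
  have hconv : Convex ℝ C₀ := by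
    intro x hx y hy a b ha hb hab
    rw [hC₀] at *
    have := hC hx hy ha hb hab
    convert this using 1
    push_cast
    rw [smul_add, smul_add, add_add_add_comm, ← add_smul, hab, one_smul]
  have hint : interior C₀ = φ ⁻¹' interior ((↑) ⁻¹' C) := (φ.preimage_interior _).symm
  have hintne : (interior C₀).Nonempty := by
    obtain ⟨z, hz⟩ := hin
    obtain ⟨y, hy, rfl⟩ := mem_intrinsicInterior.mp hz
    refine ⟨φ.symm y, ?_⟩
    rw [hint, mem_preimage, φ.apply_symm_apply]
    exact hy
  have h0 : (0 : D) ∉ interior C₀ := by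
    intro h0
    rw [hint, mem_preimage] at h0
    refine hn (mem_intrinsicInterior.mpr ⟨_, h0, ?_⟩)
    rw [hφ]
    simp
  obtain ⟨f, hf⟩ := geometric_hahn_banach_open_point hconv.interior isOpen_interior h0
  rw [map_zero] at hf
  have hf' : ∀ u ∈ C₀, f u ≤ 0 := by
    intro u hu
    have h1 : u ∈ closure (interior C₀) := by
      rw [hconv.closure_interior_eq_closure_of_nonempty_interior hintne]
      exact subset_closure hu
    have h2 : closure (interior C₀) ⊆ f ⁻¹' (Iic 0) :=
      closure_minimal (fun a ha => (hf a ha).le) (isClosed_Iic.preimage f.continuous)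
    exact h2 h1
  obtain ⟨l, hl⟩ := LinearMap.exists_extend (f : D →ₗ[ℝ] ℝ)
  have hl' : ∀ u : D, l u = f u := fun u => LinearMap.congr_fun hl u
  have key := h l.toAffineMap
  simp only [LinearMap.coe_toAffineMap] at key
  have hsub : ∀ x ∈ C, ∃ u ∈ C₀, l x - l p = f u := by
    intro x hx
    have hu : x - p ∈ D := AffineSubspace.vsub_mem_direction (subset_affineSpan ℝ C hx) hp
    refine ⟨⟨x - p, hu⟩, ?_, ?_⟩
    · rw [hC₀]
      simpa using hx
    · rw [← hl', ← map_sub]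
  have hall := key (fun x hx => by
    obtain ⟨u, hu, he⟩ := hsub x hx
    have := hf' u hu
    linarith)
  obtain ⟨a, ha⟩ := hintne
  have h1 := hf a ha
  have h2 := hall _ ((hC₀ a).mp (interior_subset ha))
  rw [map_add, hl'] at h2
  linarith

end RelativeInterior

/-! ### Affine isomorphisms and the invariants they preserve -/

section AffEquiv

variable {q r : ℕ} {P : Set (Fin q → ℝ)} {R : Set (Fin r → ℝ)}

/-- From a relative interior point one can move a little along any direction of the span; a
direction killed by the linear part would give two points of P with the same image. -/
theorem linear_injOn_vectorSpan (hP : Convex ℝ P) {f : (Fin q → ℝ) →ᵃ[ℝ] (Fin r → ℝ)}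
    (hf : InjOn f P) {u : Fin q → ℝ} (hu : u ∈ vectorSpan ℝ P) (h0 : f.linear u = 0) : u = 0 := by
  rcases P.eq_empty_or_nonempty with rfl | hne
  · simpa using hu
  obtain ⟨p, hp⟩ := hne.intrinsicInterior hP
  have hpP := intrinsicInterior_subset hp
  have hz : u +ᵥ p ∈ affineSpan ℝ P :=
    AffineSubspace.vadd_mem_of_mem_direction (by rwa [direction_affineSpan])
      (subset_affineSpan ℝ P hpP)
  obtain ⟨ε, hε, hm⟩ := exists_lineMap_mem_of_mem_intrinsicInterior hp hz
  have h1 : f (AffineMap.lineMap p (u +ᵥ p) ε) = f p := by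
    rw [AffineMap.apply_lineMap, f.map_vadd, h0, zero_vadd, AffineMap.lineMap_same_apply]
  have h2 := hf hm hpP h1
  rw [AffineMap.lineMap_apply] at h2
  simp only [vadd_eq_add, vsub_eq_sub, add_sub_cancel_right] at h2
  have h3 : ε • u = 0 := by simpa using h2
  exact (smul_eq_zero.mp h3).resolve_left hε.ne'

/-- An affine isomorphism of nonempty convex sets has an affine inverse. -/
theorem AffEquiv.exists_inverse (hP : Convex ℝ P) (hne : P.Nonempty) (h : AffEquiv P R) :
    ∃ (f : (Fin q → ℝ) →ᵃ[ℝ] (Fin r → ℝ)) (f' : (Fin r → ℝ) →ᵃ[ℝ] (Fin q → ℝ)),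
      f '' P = R ∧ f' '' R = P ∧ (∀ x ∈ P, f' (f x) = x) ∧ ∀ y ∈ R, f (f' y) = y := by
  obtain ⟨f, hf⟩ := h
  obtain ⟨p, hp⟩ := hne
  have hinj : LinearMap.ker (f.linear ∘ₗ (vectorSpan ℝ P).subtype) = ⊥ := by
    rw [LinearMap.ker_eq_bot']
    intro u hu
    exact Subtype.ext (linear_injOn_vectorSpan hP hf.injOn u.2 hu)
  -- The ambient map need not be injective, so only its linear part on the directions of P is
  -- inverted.
  obtain ⟨g, hg⟩ := LinearMap.exists_leftInverse_of_injective _ hinj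
  let f' : (Fin r → ℝ) →ᵃ[ℝ] (Fin q → ℝ) :=
    ((vectorSpan ℝ P).subtype ∘ₗ g).toAffineMap +
      AffineMap.const ℝ _ (p - (g (f p) : Fin q → ℝ))
  have hf' : ∀ y, f' y = (g y : Fin q → ℝ) + (p - (g (f p) : Fin q → ℝ)) := fun y => by
    simp [f']
  have hl : ∀ x ∈ P, f' (f x) = x := by
    intro x hx
    have h1 : g (f.linear (x - p)) = ⟨x - p, vsub_mem_vectorSpan ℝ hx hp⟩ :=
      LinearMap.congr_fun hg ⟨x - p, vsub_mem_vectorSpan ℝ hx hp⟩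
    have h2 := f.linearMap_vsub x p
    simp only [vsub_eq_sub] at h2
    rw [h2, map_sub] at h1
    have h3 : (g (f x) : Fin q → ℝ) - g (f p) = x - p := by
      rw [← Submodule.coe_sub, h1]
    rw [hf', add_sub_left_comm, h3]
    abel
  have hr : ∀ y ∈ R, f (f' y) = y := by
    intro y hy
    obtain ⟨x, hx, rfl⟩ := hf.surjOn hy
    rw [hl x hx]
  refine ⟨f, f', hf.image_eq, ?_, hl, hr⟩
  rw [← hf.image_eq, image_image]
  exact (image_congr hl).trans (image_id' P)

theorem AffEquiv.of_inverse (f : (Fin q → ℝ) →ᵃ[ℝ] (Fin r → ℝ))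
    {f' : (Fin r → ℝ) → (Fin q → ℝ)} (h : f '' P = R) (hl : ∀ x ∈ P, f' (f x) = x) :
    AffEquiv P R :=
  ⟨f, fun _ hx => h ▸ mem_image_of_mem f hx, LeftInvOn.injOn hl, h.ge⟩

theorem AffEquiv.refl (P : Set (Fin q → ℝ)) : AffEquiv P P :=
  ⟨AffineMap.id ℝ _, bijOn_id P⟩

theorem AffEquiv.symm (hP : Convex ℝ P) (hne : P.Nonempty) (h : AffEquiv P R) : AffEquiv R P := by
  obtain ⟨f, f', -, h2, -, h4⟩ := h.exists_inverse hP hne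
  exact AffEquiv.of_inverse f' h2 h4

theorem AffEquiv.trans {s : ℕ} {T : Set (Fin s → ℝ)} (h : AffEquiv P R) (h' : AffEquiv R T) :
    AffEquiv P T := by
  obtain ⟨f, hf⟩ := h
  obtain ⟨g, hg⟩ := h'
  exact ⟨g.comp f, hg.comp hf⟩

theorem AffEquiv.isPolytope (hP : IsPolytope P) (h : AffEquiv P R) : IsPolytope R := by
  obtain ⟨f, hf⟩ := h
  rw [← hf.image_eq]
  exact hP.image f

theorem AffEquiv.dim_eq (hP : Convex ℝ P) (h : AffEquiv P R) : dim P = dim R := by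
  obtain ⟨f, hf⟩ := h
  have h1 : vectorSpan ℝ R = (vectorSpan ℝ P).map f.linear := by
    rw [← hf.image_eq, AffineMap.map_vectorSpan]
  rw [dim, dim, h1]
  exact (finrank_map_of_forall fun u hu => linear_injOn_vectorSpan hP hf.injOn hu).symm

theorem isExposed_image {f : (Fin q → ℝ) →ᵃ[ℝ] (Fin r → ℝ)}
    {f' : (Fin r → ℝ) →ᵃ[ℝ] (Fin q → ℝ)} (hR : f '' P = R) (hl : ∀ x ∈ P, f' (f x) = x)
    {F : Set (Fin q → ℝ)} (hF : IsExposed ℝ P F) : IsExposed ℝ R (f '' F) := by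
  obtain ⟨g, hg, rfl⟩ := exists_affineMap_of_isExposed hF
  have : f '' {x ∈ P | g x = 0} = {y ∈ R | (g.comp f') y = 0} := by
    subst hR
    ext y
    constructor
    · rintro ⟨x, ⟨hx, hgx⟩, rfl⟩
      exact ⟨mem_image_of_mem f hx, by simp [hl x hx, hgx]⟩
    · rintro ⟨⟨x, hx, rfl⟩, h0⟩
      exact ⟨x, ⟨hx, by simpa [hl x hx] using h0⟩, rfl⟩
  rw [this]
  apply isExposed_zeros
  subst hR
  rintro _ ⟨x, hx, rfl⟩
  simpa [hl x hx] using hg x hx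

theorem AffEquiv.combEquiv (hP : Convex ℝ P) (hne : P.Nonempty) (h : AffEquiv P R) :
    CombEquiv P R := by
  obtain ⟨f, f', h1, h2, h3, h4⟩ := h.exists_inverse hP hne
  refine ⟨{ toFun := fun F => ⟨f '' F.1, isExposed_image h1 h3 F.2⟩
            invFun := fun F => ⟨f' '' F.1, isExposed_image h2 h4 F.2⟩
            left_inv := ?_
            right_inv := ?_
            map_rel_iff' := ?_ }⟩
  · rintro ⟨F, hF⟩
    apply Subtype.ext
    simp only [image_image]
    exact (image_congr fun x hx => h3 x (hF.subset hx)).trans (image_id' F)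
  · rintro ⟨F, hF⟩
    apply Subtype.ext
    simp only [image_image]
    exact (image_congr fun x hx => h4 x (hF.subset hx)).trans (image_id' F)
  · rintro ⟨F, hF⟩ ⟨G, hG⟩
    simp only [Equiv.coe_fn_mk, Subtype.mk_le_mk]
    exact (LeftInvOn.injOn h3).image_subset_image_iff hF.subset hG.subset

theorem CombEquiv.symm (h : CombEquiv P R) : CombEquiv R P := h.map OrderIso.symm

theorem CombEquiv.trans {s : ℕ} {T : Set (Fin s → ℝ)} (h : CombEquiv P R) (h' : CombEquiv R T) :
    CombEquiv P T := by
  obtain ⟨e⟩ := h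
  obtain ⟨e'⟩ := h'
  exact ⟨e.trans e'⟩

end AffEquiv

/-! ### Facets -/

section Facets

variable {q : ℕ} {P F : Set (Fin q → ℝ)} {v : Fin q → ℝ}

theorem dim_insert_of_exposed (hF : IsExposed ℝ P F) (hne : F.Nonempty) (hv : v ∈ P)
    (hvF : v ∉ F) : dim F + 1 = dim (insert v F) := by
  apply le_antisymm
  · obtain ⟨f, hf, hFe⟩ := exists_affineMap_of_isExposed hF
    obtain ⟨x, hx⟩ := hne
    apply Nat.succ_le_of_lt
    apply Submodule.finrank_lt_finrank_of_lt
    refine lt_of_le_of_ne (vectorSpan_mono ℝ (subset_insert v F)) fun he => ?_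
    have h1 : v - x ∈ vectorSpan ℝ F := by
      rw [he]
      exact vsub_mem_vectorSpan ℝ (mem_insert v F) (mem_insert_of_mem v hx)
    have h2 := linear_eq_zero_of_mem_vectorSpan (f := f) (c := 0)
      (fun y hy => by rw [hFe] at hy; exact hy.2) h1
    have h3 := f.linearMap_vsub v x
    simp only [vsub_eq_sub] at h3
    rw [hFe] at hx hvF
    rw [h2, hx.2, sub_zero] at h3
    exact hvF ⟨hv, h3.symm⟩
  · exact finrank_vectorSpan_insert_le_set ℝ F v

/-- Every face of a polytope avoiding a point `v` is contained in a facet avoiding `v`. -/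
theorem exists_facet_superset (hP : IsPolytope P) (hd : 1 ≤ dim P) (hv : v ∈ P)
    (hF : IsExposed ℝ P F) (hvF : v ∉ F) : ∃ G, IsFacet P G ∧ F ⊆ G ∧ v ∉ G := by
  induction hk : dim P - dim (insert v F) using Nat.strong_induction_on generalizing F with
  | _ k ih =>
  have hsub : insert v F ⊆ P := insert_subset hv hF.subset
  have hle := vectorSpan_mono ℝ hsub
  -- If v and F already span P, then F is a facet; otherwise F is enlarged while still avoiding v.
  by_cases heq : vectorSpan ℝ P ≤ vectorSpan ℝ (insert v F)
  · have heq' : dim P = dim (insert v F) := by rw [dim, dim, le_antisymm heq hle]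
    have hne : F.Nonempty := by
      rw [nonempty_iff_ne_empty]
      rintro rfl
      simp [dim] at heq'
      simp [dim, heq'] at hd
    exact ⟨F, ⟨hF, hne, by rw [dim_insert_of_exposed hF hne hv hvF, heq']⟩, Subset.rfl, hvF⟩
  obtain ⟨h, hh, x₀, hx₀, hx₀pos⟩ : ∃ h : (Fin q → ℝ) →ᵃ[ℝ] ℝ, (∀ x ∈ insert v F, h x = 0) ∧
      ∃ x ∈ P, 0 < h x := by
    have h1 := mt vectorSpan_le_vectorSpan_of_forall heq
    push Not at h1
    obtain ⟨l, hl, x, hx, y, hy, hxy⟩ := h1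
    obtain ⟨z, hz, hzv⟩ : ∃ z ∈ P, l z ≠ l v := by
      by_cases hxv : l x = l v
      · exact ⟨y, hy, fun hyv => hxy (hxv.trans hyv.symm)⟩
      · exact ⟨x, hx, hxv⟩
    have hl0 : ∀ x ∈ insert v F, l x = l v := fun x hx => hl x hx v (mem_insert v F)
    rcases lt_or_gt_of_ne hzv with hlt | hgt
    · refine ⟨AffineMap.const ℝ _ (l v) - l.toAffineMap, fun x hx => ?_, z, hz, ?_⟩
      · simp [hl0 x hx]
      · simpa using hlt
    · refine ⟨l.toAffineMap - AffineMap.const ℝ _ (l v), fun x hx => ?_, z, hz, ?_⟩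
      · simp [hl0 x hx]
      · simpa using hgt
  obtain ⟨f, hf, hFe⟩ := exists_affineMap_of_isExposed hF
  have hfneg : ∀ x ∈ P, h x ≠ 0 → f x < 0 := fun x hx hne =>
    lt_of_le_of_ne (hf x hx) fun h0 =>
      hne (hh x (mem_insert_of_mem v (by rw [hFe]; exact ⟨hx, h0⟩)))
  obtain ⟨t, ht, hPt⟩ := hP
  have htP : ∀ x ∈ t, x ∈ P := fun x hx => by rw [hPt]; exact subset_convexHull ℝ _ hx
  have hne : (t.filter fun x => 0 < h x).Nonempty := by
    by_contra hemp
    rw [Finset.not_nonempty_iff_eq_empty, Finset.filter_eq_empty_iff] at hemp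
    have := affineMap_le_on_convexHull (T := (t : Set (Fin q → ℝ))) h (c := 0)
      (fun x hx => not_lt.mp (hemp hx)) x₀ (by rwa [← hPt])
    linarith
  -- Tilt f to τ f + h. The largest ratio h / (-f) is the least τ keeping this nonpositive on all
  -- generators; the generator y attaining it joins the face, while v stays off because h v = 0 and
  -- f v < 0.
  obtain ⟨y, hy, hmax⟩ := Finset.exists_max_image _ (fun x => h x / (- f x)) hne
  rw [Finset.mem_filter] at hy
  have hyP := htP y hy.1
  have hfy := hfneg y hyP hy.2.ne'
  set τ := h y / (- f y) with hτ
  have hτpos : 0 < τ := div_pos hy.2 (by linarith)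
  have hf'P : ∀ x ∈ P, (τ • f + h) x ≤ 0 := by
    rw [hPt]
    apply affineMap_le_on_convexHull
    intro x hx
    simp only [AffineMap.coe_add, AffineMap.coe_smul, Pi.add_apply, Pi.smul_apply, smul_eq_mul]
    by_cases hx0 : 0 < h x
    · have h1 := hmax x (Finset.mem_filter.mpr ⟨hx, hx0⟩)
      have h2 := hfneg x (htP x hx) hx0.ne'
      rw [div_le_iff₀ (by linarith)] at h1
      linarith
    · have := mul_nonpos_of_nonneg_of_nonpos hτpos.le (hf x (htP x hx))
      linarith
  have hvneg : f v < 0 := lt_of_le_of_ne (hf v hv) fun h0 => hvF (by rw [hFe]; exact ⟨hv, h0⟩)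
  have hhv : h v = 0 := hh v (mem_insert v F)
  have hFF' : F ⊆ {x ∈ P | (τ • f + h) x = 0} := by
    intro x hx
    refine ⟨hF.subset hx, ?_⟩
    have h1 := hh x (mem_insert_of_mem v hx)
    rw [hFe] at hx
    simp [h1, hx.2]
  have hvF' : v ∉ {x ∈ P | (τ • f + h) x = 0} := by
    rintro ⟨-, h0⟩
    simp only [AffineMap.coe_add, AffineMap.coe_smul, Pi.add_apply, Pi.smul_apply, smul_eq_mul,
      hhv, add_zero] at h0
    exact (mul_neg_of_pos_of_neg hτpos hvneg).ne h0
  have hyF' : y ∈ {x ∈ P | (τ • f + h) x = 0} := by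
    refine ⟨hyP, ?_⟩
    simp only [AffineMap.coe_add, AffineMap.coe_smul, Pi.add_apply, Pi.smul_apply, smul_eq_mul, hτ]
    field_simp [hfy.ne]
    ring
  have hE := isExposed_zeros hf'P
  have hlt : dim P - dim (insert v {x ∈ P | (τ • f + h) x = 0}) < k := by
    rw [← hk]
    have h1 : dim (insert v F) < dim (insert v {x ∈ P | (τ • f + h) x = 0}) := by
      apply Submodule.finrank_lt_finrank_of_lt
      refine lt_of_le_of_ne (vectorSpan_mono ℝ (insert_subset_insert hFF')) fun he => ?_
      have h1 : y - v ∈ vectorSpan ℝ (insert v F) := by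
        rw [he]
        exact vsub_mem_vectorSpan ℝ (mem_insert_of_mem v hyF') (mem_insert v _)
      have h2 := linear_eq_zero_of_mem_vectorSpan hh h1
      have h3 := h.linearMap_vsub y v
      simp only [vsub_eq_sub] at h3
      rw [h2, hhv] at h3
      linarith [hy.2]
    have h2 : dim (insert v {x ∈ P | (τ • f + h) x = 0}) ≤ dim P :=
      Submodule.finrank_mono (vectorSpan_mono ℝ (insert_subset hv hE.subset))
    omega
  obtain ⟨G, hG, hFG, hvG⟩ := ih _ hlt hE hvF' rfl
  exact ⟨G, hG, hFF'.trans hFG, hvG⟩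

/-- Two affine functions vanishing on a facet are proportional on the polytope. -/
theorem IsFacet.mul_eq_mul (hF : IsFacet P F) {f g : (Fin q → ℝ) →ᵃ[ℝ] ℝ}
    (hf : ∀ x ∈ F, f x = 0) (hg : ∀ x ∈ F, g x = 0) {x y : Fin q → ℝ} (hx : x ∈ P) (hy : y ∈ P) :
    f x * g y = f y * g x := by
  obtain ⟨hE, ⟨z, hz⟩, hd⟩ := hF
  by_cases hfx : f x = 0 ∧ f y = 0
  · rw [hfx.1, hfx.2]
    ring
  have hlin : ∀ (k : (Fin q → ℝ) →ᵃ[ℝ] ℝ), (∀ x ∈ F, k x = 0) → ∀ w, k.linear (w - z) = k w := by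
    intro k hk w
    have := k.linearMap_vsub w z
    simp only [vsub_eq_sub] at this
    rw [this, hk z hz, sub_zero]
  have hzP := hE.subset hz
  have hle : vectorSpan ℝ F ≤ vectorSpan ℝ P ⊓ LinearMap.ker f.linear := fun u hu =>
    ⟨vectorSpan_mono ℝ hE.subset hu, linear_eq_zero_of_mem_vectorSpan hf hu⟩
  have hlt : vectorSpan ℝ P ⊓ LinearMap.ker f.linear < vectorSpan ℝ P := by
    refine lt_of_le_of_ne inf_le_left fun he => hfx ?_
    have h1 : ∀ w ∈ P, f w = 0 := by
      intro w hw
      rw [← hlin f hf]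
      have : w - z ∈ vectorSpan ℝ P := vsub_mem_vectorSpan ℝ hw hzP
      rw [← he] at this
      exact this.2
    exact ⟨h1 x hx, h1 y hy⟩
  -- By codimension one, the directions of F are exactly the directions of P killed by f. The
  -- combination below is such a direction, so g kills it too, which is the proportionality.
  have heq : vectorSpan ℝ F = vectorSpan ℝ P ⊓ LinearMap.ker f.linear := by
    apply Submodule.eq_of_le_of_finrank_le hle
    have := Submodule.finrank_lt_finrank_of_lt hlt
    unfold dim at hd
    omega
  have hmem : f x • (y - z) - f y • (x - z) ∈ vectorSpan ℝ F := by
    rw [heq]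
    refine ⟨sub_mem (Submodule.smul_mem _ _ (vsub_mem_vectorSpan ℝ hy hzP))
      (Submodule.smul_mem _ _ (vsub_mem_vectorSpan ℝ hx hzP)), ?_⟩
    rw [SetLike.mem_coe, LinearMap.mem_ker, map_sub, map_smul, map_smul, hlin f hf,
      hlin f hf, smul_eq_mul, smul_eq_mul]
    ring
  have := linear_eq_zero_of_mem_vectorSpan hg hmem
  rw [map_sub, map_smul, map_smul, hlin g hg, hlin g hg, smul_eq_mul, smul_eq_mul] at this
  linarith

end Facets

/-! ### Vertices of polytopes -/

section Vertices

variable {q : ℕ} {P : Set (Fin q → ℝ)}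

theorem IsPolytope.finite_extremePoints (hP : IsPolytope P) : (P.extremePoints ℝ).Finite := by
  obtain ⟨t, -, rfl⟩ := hP
  exact t.finite_toSet.subset extremePoints_convexHull_subset

theorem IsPolytope.convexHull_extremePoints (hP : IsPolytope P) :
    convexHull ℝ (P.extremePoints ℝ) = P := by
  have h := closure_convexHull_extremePoints hP.isCompact hP.convex
  rwa [(hP.finite_extremePoints.isClosed_convexHull ℝ).closure_eq] at h

/-- A vertex is strictly separated from the compact hull of the other vertices, and the separating
functional exposes it. -/
theorem IsPolytope.isExposed_singleton (hP : IsPolytope P) {x : Fin q → ℝ}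
    (hx : x ∈ P.extremePoints ℝ) : IsExposed ℝ P {x} := by
  have h1 : x ∉ convexHull ℝ (P.extremePoints ℝ \ {x}) := fun h =>
    (hP.convex.mem_extremePoints_iff_mem_sdiff_convexHull_sdiff.mp hx).2
      (convexHull_mono (sdiff_subset_sdiff_left extremePoints_subset) h)
  obtain ⟨l, u, hl, hu⟩ := geometric_hahn_banach_closed_point (convex_convexHull ℝ _)
    (((hP.finite_extremePoints).subset sdiff_subset).isClosed_convexHull ℝ) h1
  let f : (Fin q → ℝ) →ᵃ[ℝ] ℝ :=
    (l : (Fin q → ℝ) →ₗ[ℝ] ℝ).toAffineMap - AffineMap.const ℝ _ (l x)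
  have hf : ∀ y, f y = l y - l x := fun y => by simp [f]
  have hlt : ∀ y ∈ P.extremePoints ℝ, y ≠ x → f y < 0 := fun y hy hne => by
    have := hl y (subset_convexHull ℝ _ ⟨hy, hne⟩)
    rw [hf]
    linarith
  have hle : ∀ y ∈ P.extremePoints ℝ, f y ≤ 0 := fun y hy => by
    by_cases h : y = x
    · rw [hf, h, sub_self]
    · exact (hlt y hy h).le
  have hz := zeros_convexHull f hle
  have hs : {y ∈ P.extremePoints ℝ | f y = 0} = {x} := by
    ext y
    simp only [mem_ofPred_eq, mem_singleton_iff]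
    constructor
    · rintro ⟨hy, h0⟩
      by_contra hne
      exact (hlt y hy hne).ne h0
    · rintro rfl
      exact ⟨hx, by rw [hf, sub_self]⟩
  rw [hs, convexHull_singleton, hP.convexHull_extremePoints] at hz
  rw [← hz]
  apply isExposed_zeros
  rw [← hP.convexHull_extremePoints]
  exact affineMap_le_on_convexHull f hle

theorem IsPolytope.exists_extremePoint_mem (hP : IsPolytope P) {F : Set (Fin q → ℝ)}
    (hF : IsExposed ℝ P F) (hne : F.Nonempty) : ∃ x ∈ F, x ∈ P.extremePoints ℝ := by
  obtain ⟨x, hx⟩ := (hF.isCompact hP.isCompact).extremePoints_nonempty hne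
  exact ⟨x, hx.1, hF.isExtreme.extremePoints_subset_extremePoints hx⟩

end Vertices

/-- `P` is the convex hull of a family of points `v` and a polytope `C` that meet transversally in
the point `p = ∑ k, lam k • v k`, which is a relative interior point of `C`. Transversality is
expressed as the existence of affine functions with prescribed compatible values. -/
structure SplitHull {ι : Type} [Fintype ι] {q : ℕ} (v : ι → Fin q → ℝ) (lam : ι → ℝ)
    (p : Fin q → ℝ) (C P : Set (Fin q → ℝ)) : Prop where
  nonneg : ∀ k, 0 ≤ lam k
  lt_one : ∀ k, lam k < 1
  sum_eq_one : ∑ k, lam k = 1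
  center_eq : p = ∑ k, lam k • v k
  polytope : IsPolytope C
  center_mem : p ∈ C
  relint : ∀ g : (Fin q → ℝ) →ᵃ[ℝ] ℝ, (∀ x ∈ C, g x ≤ g p) → ∀ x ∈ C, g x = g p
  extend : ∀ (α : ι → ℝ) (g : (Fin q → ℝ) →ᵃ[ℝ] ℝ), g p = ∑ k, lam k * α k →
    ∃ f : (Fin q → ℝ) →ᵃ[ℝ] ℝ, (∀ k, f (v k) = α k) ∧ ∀ x ∈ C, f x = g x
  hull : P = convexHull ℝ (range v ∪ C)

/-! ### Split hulls: special simplex, rest complex and basis polytope -/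

namespace SplitHull

variable {ι : Type} [Fintype ι] {q : ℕ} {v : ι → Fin q → ℝ} {lam : ι → ℝ} {p : Fin q → ℝ}
  {C P : Set (Fin q → ℝ)}

theorem point_mem (h : SplitHull v lam p C P) (k : ι) : v k ∈ P := by
  rw [h.hull]
  exact subset_convexHull ℝ _ (Or.inl ⟨k, rfl⟩)

theorem subset (h : SplitHull v lam p C P) : C ⊆ P := by
  rw [h.hull]
  exact subset_union_right.trans (subset_convexHull ℝ _)

theorem isPolytope (h : SplitHull v lam p C P) : IsPolytope P := by
  classical
  obtain ⟨t, ht, hC⟩ := h.polytope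
  refine ⟨Finset.univ.image v ∪ t, ht.mono Finset.subset_union_right, ?_⟩
  rw [h.hull, hC, convexHull_convexHull_union_right]
  simp

theorem apply_center (h : SplitHull v lam p C P) {r : ℕ} (g : (Fin q → ℝ) →ᵃ[ℝ] (Fin r → ℝ)) :
    g p = ∑ k, lam k • g (v k) := by
  rw [h.center_eq, affineMap_sum g v h.sum_eq_one]

theorem apply_center_real (h : SplitHull v lam p C P) (g : (Fin q → ℝ) →ᵃ[ℝ] ℝ) :
    g p = ∑ k, lam k * g (v k) := by
  rw [h.center_eq, affineMap_sum g v h.sum_eq_one]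
  rfl

theorem le_of_forall (h : SplitHull v lam p C P) {f : (Fin q → ℝ) →ᵃ[ℝ] ℝ} {c : ℝ}
    (hv : ∀ k, f (v k) ≤ c) (hC : ∀ x ∈ C, f x ≤ c) : ∀ x ∈ P, f x ≤ c := by
  rw [h.hull]
  apply affineMap_le_on_convexHull
  rintro x (⟨k, rfl⟩ | hx)
  exacts [hv k, hC x hx]

theorem eqOn_of_forall (h : SplitHull v lam p C P) {W : Type*} [AddCommGroup W] [Module ℝ W]
    {f g : (Fin q → ℝ) →ᵃ[ℝ] W}
    (hv : ∀ k, f (v k) = g (v k)) (hC : ∀ x ∈ C, f x = g x) : ∀ x ∈ P, f x = g x := by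
  rw [h.hull]
  apply affineMap_eqOn_convexHull
  rintro x (⟨k, rfl⟩ | hx)
  exacts [hv k, hC x hx]

theorem zeros_eq (h : SplitHull v lam p C P) {f : (Fin q → ℝ) →ᵃ[ℝ] ℝ} (hf : ∀ x ∈ P, f x ≤ 0) :
    {x ∈ P | f x = 0} = convexHull ℝ {x ∈ range v ∪ C | f x = 0} := by
  rw [h.hull] at hf ⊢
  exact zeros_convexHull f fun x hx => hf x (subset_convexHull ℝ _ hx)

theorem extend_pi (h : SplitHull v lam p C P) {κ : Type} (α : ι → κ → ℝ)
    (g : (Fin q → ℝ) →ᵃ[ℝ] (κ → ℝ)) (hg : g p = ∑ k, lam k • α k) :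
    ∃ f : (Fin q → ℝ) →ᵃ[ℝ] (κ → ℝ), (∀ k, f (v k) = α k) ∧ ∀ x ∈ C, f x = g x := by
  have h1 : ∀ c : κ, ∃ f : (Fin q → ℝ) →ᵃ[ℝ] ℝ, (∀ k, f (v k) = α k c) ∧ ∀ x ∈ C, f x = g x c := by
    intro c
    refine h.extend (fun k => α k c) ((LinearMap.proj c : (κ → ℝ) →ₗ[ℝ] ℝ).toAffineMap.comp g) ?_
    simp [hg]
  choose f hf hf' using h1
  exact ⟨AffineMap.pi f, fun k => funext fun c => hf c k, fun x hx => funext fun c => hf' c x hx⟩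

theorem exists_coordinates (h : SplitHull v lam p C P) [DecidableEq ι] :
    ∃ Φ : (Fin q → ℝ) →ᵃ[ℝ] (ι → ℝ), (∀ k, Φ (v k) = Pi.single k 1) ∧ ∀ x ∈ C, Φ x = lam := by
  refine h.extend_pi (fun k => Pi.single k 1) (AffineMap.const ℝ _ lam) ?_
  ext k
  simp [Finset.sum_apply, Pi.single_apply]

theorem affineIndependent (h : SplitHull v lam p C P) : AffineIndependent ℝ v := by
  classical
  obtain ⟨Φ, hΦ, -⟩ := h.exists_coordinates
  refine AffineIndependent.of_comp Φ ?_
  rw [affineIndependent_iff]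
  intro s w _ hw k hk
  have := congrFun hw k
  simpa [Function.comp_def, hΦ, Finset.sum_apply, Pi.single_apply, hk] using this

theorem injective (h : SplitHull v lam p C P) : Function.Injective v :=
  h.affineIndependent.injective

/-- The barycentric coordinate map Φ is constant on C, while composing it with the map sending
weights to combinations of the v k gives the identity on directions of the simplex. A common
direction is therefore zero. -/
theorem disjoint_vectorSpan (h : SplitHull v lam p C P) :
    Disjoint (vectorSpan ℝ (range v)) (vectorSpan ℝ C) := by
  classical
  obtain ⟨Φ, hΦ, hΦC⟩ := h.exists_coordinates
  let Ψ : (ι → ℝ) →ₗ[ℝ] (Fin q → ℝ) := Fintype.linearCombination ℝ v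
  rw [Submodule.disjoint_def]
  intro x hx hxC
  have h1 : (Ψ.toAffineMap.comp Φ).linear x = (AffineMap.id ℝ (Fin q → ℝ)).linear x := by
    refine linear_eq_of_mem_vectorSpan ?_ hx
    rintro _ ⟨k, rfl⟩
    simp [hΦ, Ψ]
  have h2 := linear_eq_zero_of_mem_vectorSpan hΦC hxC
  simpa [h2] using h1.symm

theorem center_sub_mem (h : SplitHull v lam p C P) (k : ι) : v k - p ∈ vectorSpan ℝ (range v) := by
  have hp : v k - p = ∑ l, lam l • (v k - v l) := by
    simp_rw [smul_sub, Finset.sum_sub_distrib, ← Finset.sum_smul, h.sum_eq_one, one_smul,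
      h.center_eq]
  rw [hp]
  exact sum_mem fun l _ => Submodule.smul_mem _ _ (vsub_mem_vectorSpan ℝ ⟨k, rfl⟩ ⟨l, rfl⟩)

theorem vectorSpan_eq (h : SplitHull v lam p C P) :
    vectorSpan ℝ P = vectorSpan ℝ (range v) ⊔ vectorSpan ℝ C := by
  apply le_antisymm
  · have h0 : vectorSpan ℝ P = vectorSpan ℝ (range v ∪ C) := by
      rw [h.hull, ← direction_affineSpan, affineSpan_convexHull, direction_affineSpan]
    have key : ∀ x ∈ range v ∪ C, x - p ∈ vectorSpan ℝ (range v) ⊔ vectorSpan ℝ C := by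
      rintro x (⟨k, rfl⟩ | hx)
      · exact Submodule.mem_sup_left (h.center_sub_mem k)
      · exact Submodule.mem_sup_right (vsub_mem_vectorSpan ℝ hx h.center_mem)
    rw [h0, vectorSpan_le_iff]
    intro x hx y hy
    have := sub_mem (key x hx) (key y hy)
    rwa [sub_sub_sub_cancel_right] at this
  · refine sup_le (vectorSpan_mono ℝ ?_) (vectorSpan_mono ℝ h.subset)
    rintro _ ⟨k, rfl⟩
    exact h.point_mem k

theorem dim_eq (h : SplitHull v lam p C P) {m : ℕ} (hm : Fintype.card ι = m + 1) :
    dim P = dim C + m := by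
  have h1 := Submodule.finrank_sup_add_finrank_inf_eq (vectorSpan ℝ (range v)) (vectorSpan ℝ C)
  rw [h.disjoint_vectorSpan.eq_bot, finrank_bot, h.affineIndependent.finrank_vectorSpan hm] at h1
  rw [dim, dim, h.vectorSpan_eq]
  omega

theorem isExposed_point (h : SplitHull v lam p C P) (k : ι) : IsExposed ℝ P {v k} := by
  classical
  -- Barycentric coordinate minus 1: it vanishes at v k, is -1 at the other points, and equals lam k
  -- - 1 on C. The last value is negative because lam k < 1.
  obtain ⟨f, hf, hfC⟩ := h.extend (fun l => (Pi.single k 1 : ι → ℝ) l - 1)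
    (AffineMap.const ℝ _ (lam k - 1)) (by
      simp [mul_sub, Finset.sum_sub_distrib, h.sum_eq_one, Pi.single_apply])
  have hlt := h.lt_one k
  have hv : ∀ l, l ≠ k → f (v l) < 0 := fun l hl => by simp [hf, hl]
  have hk : f (v k) = 0 := by simp [hf]
  have hC : ∀ x ∈ C, f x < 0 := fun x hx => by
    rw [hfC x hx, AffineMap.const_apply]
    linarith
  have hle : ∀ x ∈ P, f x ≤ 0 := h.le_of_forall (fun l => by
    by_cases hl : l = k
    · rw [hl, hk]
    · exact (hv l hl).le) fun x hx => (hC x hx).le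
  have hz : {x ∈ range v ∪ C | f x = 0} = {v k} := by
    ext x
    simp only [mem_ofPred_eq, mem_singleton_iff]
    constructor
    · rintro ⟨⟨l, rfl⟩ | hx, h0⟩
      · by_contra hne
        exact (hv l fun hl => hne (by rw [hl])).ne h0
      · exact absurd h0 (hC x hx).ne
    · rintro rfl
      exact ⟨Or.inl ⟨k, rfl⟩, hk⟩
  have := isExposed_zeros hle
  rwa [h.zeros_eq hle, hz, convexHull_singleton] at this

/-- A nonpositive affine function that vanishes at all points `v k` with positive weight
vanishes on `C`. -/
theorem eq_zero_of_forall_point (h : SplitHull v lam p C P) {f : (Fin q → ℝ) →ᵃ[ℝ] ℝ}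
    (hf : ∀ x ∈ P, f x ≤ 0) (hv : ∀ k, 0 < lam k → f (v k) = 0) : ∀ x ∈ C, f x = 0 := by
  have h0 : f p = 0 := by
    rw [h.apply_center_real f]
    refine Finset.sum_eq_zero fun k _ => ?_
    rcases (h.nonneg k).eq_or_lt with h1 | h1
    · rw [← h1, zero_mul]
    · rw [hv k h1, mul_zero]
  intro x hx
  rw [h.relint f (fun x hx => by rw [h0]; exact hf x (h.subset hx)) x hx, h0]

theorem point_eq_zero (h : SplitHull v lam p C P) {f : (Fin q → ℝ) →ᵃ[ℝ] ℝ}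
    (hf : ∀ x ∈ P, f x ≤ 0) (hp : f p = 0) {k : ι} (hk : 0 < lam k) : f (v k) = 0 := by
  rw [h.apply_center_real f] at hp
  have := (Finset.sum_eq_zero_iff_of_nonpos (fun l _ =>
    mul_nonpos_of_nonneg_of_nonpos (h.nonneg l) (hf _ (h.point_mem l)))).mp hp k (Finset.mem_univ k)
  exact (mul_eq_zero.mp this).resolve_left hk.ne'

/-- A facet containing every v k contains p, hence C by relative interiority, hence P. If it missed
two points, a second affine function vanishing on it could be built that is not proportional to the
first. -/
theorem existsUnique_of_isFacet (h : SplitHull v lam p C P) {F : Set (Fin q → ℝ)}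
    (hF : IsFacet P F) : ∃! k, v k ∉ F := by
  classical
  obtain ⟨f, hf, hFe⟩ := exists_affineMap_of_isExposed hF.1
  have hmem : ∀ {x}, x ∈ P → (x ∈ F ↔ f x = 0) := fun {x} hx => by
    rw [hFe]
    exact ⟨fun h => h.2, fun h => ⟨hx, h⟩⟩
  have hex : ∃ k, v k ∉ F := by
    by_contra! hall
    have hv : ∀ k, f (v k) = 0 := fun k => (hmem (h.point_mem k)).mp (hall k)
    have h0 : ∀ x ∈ P, f x = AffineMap.const ℝ (Fin q → ℝ) (0 : ℝ) x :=
      h.eqOn_of_forall (fun k => by simp [hv]) fun x hx => by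
        simp [h.eq_zero_of_forall_point hf (fun k _ => hv k) x hx]
    have hFP : F = P := by
      rw [hFe]
      ext x
      exact ⟨fun hx => hx.1, fun hx => ⟨hx, by simpa using h0 x hx⟩⟩
    have := hF.2.2
    rw [hFP] at this
    omega
  obtain ⟨a, ha⟩ := hex
  refine ⟨a, ha, fun b hb => ?_⟩
  by_contra hab
  rw [hmem (h.point_mem _)] at ha hb
  -- This is the compatibility at p needed to glue τ f on C with the value 1 at v a and 0 at the
  -- other points. If f p = 0, then lam a = 0 since f (v a) ≠ 0, and τ = 0 works.
  obtain ⟨τ, hτ⟩ : ∃ τ : ℝ, τ * f p = lam a := by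
    by_cases hp : f p = 0
    · refine ⟨0, ?_⟩
      rw [zero_mul]
      by_contra hne
      exact ha (h.point_eq_zero hf hp (lt_of_le_of_ne (h.nonneg a) hne))
    · exact ⟨lam a / f p, div_mul_cancel₀ _ hp⟩
  obtain ⟨g, hg, hgC⟩ := h.extend (Pi.single a 1) (τ • f) (by simp [Pi.single_apply, hτ])
  have hgF : ∀ x ∈ F, g x = 0 := by
    rw [hFe, h.zeros_eq hf]
    intro x hx
    refine affineMap_eqOn_convexHull (f := g) (g := AffineMap.const ℝ _ 0) ?_ x hx
    rintro y ⟨⟨k, rfl⟩ | hy, h0⟩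
    · have : k ≠ a := fun hk => ha (hk ▸ h0)
      simp [hg, this]
    · simp [hgC y hy, h0]
  have hfF : ∀ x ∈ F, f x = 0 := fun x hx => (hmem (hF.1.subset hx)).mp hx
  -- With g (v a) = 1 and g (v b) = 0, proportionality forces f (v b) = 0.
  have := hF.mul_eq_mul hfF hgF (h.point_mem a) (h.point_mem b)
  simp [hg, hab] at this
  exact hb this.symm

theorem isSpecialSimplex (h : SplitHull v lam p C P) [DecidableEq (Fin q → ℝ)] {m : ℕ}
    (hm : Fintype.card ι = m + 1) : IsSpecialSimplex m P (Finset.univ.image v) := by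
  refine ⟨?_, ?_, ?_, ?_⟩
  · rw [Finset.card_image_of_injective _ h.injective, Finset.card_univ, hm]
  · intro x hx
    simp only [Finset.coe_image, Finset.coe_univ, image_univ] at hx
    obtain ⟨k, rfl⟩ := hx
    exact exposedPoints_subset_extremePoints
      (mem_exposedPoints_iff_exposed_singleton.mpr (h.isExposed_point k))
  · have hr := h.affineIndependent.range
    have he : ((Finset.univ.image v : Finset (Fin q → ℝ)) : Set (Fin q → ℝ)) = range v := by simp
    rw [← he] at hr
    exact hr
  · intro F hF
    obtain ⟨k, hk, hu⟩ := h.existsUnique_of_isFacet hF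
    refine ⟨v k, ⟨Finset.mem_image_of_mem v (Finset.mem_univ k), hk⟩, ?_⟩
    rintro x ⟨hx, hxF⟩
    obtain ⟨l, -, rfl⟩ := Finset.mem_image.mp hx
    rw [hu l hxF]

theorem restComplexSupport_subset (h : SplitHull v lam p C P) [DecidableEq (Fin q → ℝ)] :
    restComplexSupport P (Finset.univ.image v) ⊆ C := by
  rintro x ⟨F, ⟨hF, hd⟩, hx⟩
  obtain ⟨f, hf, hFe⟩ := exists_affineMap_of_isExposed hF
  rw [hFe, h.zeros_eq hf] at hx
  refine convexHull_min ?_ h.polytope.convex hx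
  rintro y ⟨⟨k, rfl⟩ | hy, h0⟩
  · exfalso
    refine disjoint_left.mp hd (show v k ∈ F from ?_) (by simp)
    rw [hFe]
    exact ⟨h.point_mem k, h0⟩
  · exact hy

theorem exists_mem_restComplexSupport (h : SplitHull v lam p C P) [DecidableEq (Fin q → ℝ)]
    {g : (Fin q → ℝ) →ᵃ[ℝ] ℝ} (hg : ∃ x ∈ C, g x ≠ g p) :
    ∃ x ∈ restComplexSupport P (Finset.univ.image v), ∀ y ∈ C, g y ≤ g x := by
  obtain ⟨z, hz, hmax⟩ := h.polytope.exists_isMaxOn g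
  have hlt : g p < g z := by
    refine lt_of_le_of_ne (hmax p h.center_mem) fun he => ?_
    obtain ⟨x, hx, hne⟩ := hg
    exact hne (h.relint g (fun y hy => by rw [he]; exact hmax y hy) x hx)
  -- The constant g p - g z on all points is compatible at p because the weights sum to 1. It is
  -- negative, so the resulting face contains z and no v k.
  obtain ⟨f, hf, hfC⟩ := h.extend (fun _ => g p - g z) (g - AffineMap.const ℝ _ (g z)) (by
    simp [← Finset.sum_mul, h.sum_eq_one])
  simp only [AffineMap.coe_sub, Pi.sub_apply, AffineMap.const_apply] at hfC
  have hle : ∀ x ∈ P, f x ≤ 0 := h.le_of_forall (fun k => by rw [hf]; linarith) fun x hx => by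
    rw [hfC x hx]
    linarith [hmax x hx]
  refine ⟨z, ⟨_, ⟨isExposed_zeros hle, ?_⟩, ⟨h.subset hz, by rw [hfC z hz, sub_self]⟩⟩, hmax⟩
  rw [disjoint_left]
  rintro x ⟨-, hx⟩ hxs
  simp only [Finset.coe_image, Finset.coe_univ, image_univ] at hxs
  obtain ⟨k, rfl⟩ := hxs
  rw [hf] at hx
  linarith

/-- A functional constant on the rest complex but not on C would attain both its maximum and its
minimum over C inside the complex, and so would be constant on C after all. -/
theorem dim_restComplexSupport (h : SplitHull v lam p C P) [DecidableEq (Fin q → ℝ)] :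
    dim (restComplexSupport P (Finset.univ.image v)) = dim C := by
  have : vectorSpan ℝ (restComplexSupport P (Finset.univ.image v)) = vectorSpan ℝ C := by
    apply le_antisymm (vectorSpan_mono ℝ h.restComplexSupport_subset)
    apply vectorSpan_le_vectorSpan_of_forall
    intro l hl
    by_contra! hne
    obtain ⟨x, hx, y, hy, hxy⟩ := hne
    obtain ⟨z, hz, hzp⟩ : ∃ z ∈ C, l z ≠ l p := by
      by_cases hxv : l x = l p
      · exact ⟨y, hy, fun hyv => hxy (hxv.trans hyv.symm)⟩
      · exact ⟨x, hx, hxv⟩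
    obtain ⟨a, ha, hamax⟩ := h.exists_mem_restComplexSupport (g := l.toAffineMap)
      ⟨z, hz, by simpa using hzp⟩
    obtain ⟨b, hb, hbmin⟩ := h.exists_mem_restComplexSupport (g := (-l).toAffineMap)
      ⟨z, hz, by simpa using hzp⟩
    simp only [LinearMap.coe_toAffineMap, LinearMap.neg_apply, neg_le_neg_iff] at hamax hbmin
    have hab := hl a ha b hb
    have h1 := hamax z hz
    have h2 := hbmin z hz
    have h3 := hamax p h.center_mem
    have h4 := hbmin p h.center_mem
    exact hzp (by linarith)
  rw [dim, dim, this]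

/-- All v k project to the image of p, which already lies in the image of C, so C alone covers the
basis polytope; complementary directions make the projection injective on C. -/
theorem affEquiv_basisPolytope (h : SplitHull v lam p C P) [DecidableEq (Fin q → ℝ)] {d : ℕ}
    {B : Set (Fin d → ℝ)} (hB : IsBasisPolytope P (Finset.univ.image v) B) : AffEquiv C B := by
  obtain ⟨π, -, hker, rfl⟩ := hB
  simp only [Finset.coe_image, Finset.coe_univ, image_univ] at hker
  have hv : ∀ k, π (v k) = π p := by
    intro k
    have := h.center_sub_mem k
    rwa [← hker, LinearMap.mem_ker, map_sub, sub_eq_zero] at this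
  refine ⟨π.toAffineMap, fun x hx => mem_image_of_mem π (h.subset hx), ?_, ?_⟩
  · intro x hx y hy hxy
    have h1 : x - y ∈ vectorSpan ℝ (range v) := by
      rw [← hker, LinearMap.mem_ker, map_sub, sub_eq_zero]
      exact hxy
    exact sub_eq_zero.mp
      (Submodule.disjoint_def.mp h.disjoint_vectorSpan _ h1 (vsub_mem_vectorSpan ℝ hx hy))
  · have h1 : P ⊆ π ⁻¹' (π '' C) := by
      rw [h.hull]
      refine convexHull_min ?_ ((h.polytope.convex.linear_image π).linear_preimage π)
      rintro x (⟨k, rfl⟩ | hx)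
      · exact ⟨p, h.center_mem, (hv k).symm⟩
      · exact ⟨x, hx, rfl⟩
    rintro _ ⟨x, hx, rfl⟩
    exact h1 hx

end SplitHull

theorem exists_isBasisPolytope {q : ℕ} (P : Set (Fin q → ℝ)) (s : Finset (Fin q → ℝ)) :
    ∃ (d : ℕ) (B : Set (Fin d → ℝ)), IsBasisPolytope P s B := by
  let U := vectorSpan ℝ (s : Set (Fin q → ℝ))
  let e := (Module.finBasis ℝ ((Fin q → ℝ) ⧸ U)).equivFun
  refine ⟨_, _, e.toLinearMap ∘ₗ U.mkQ, ?_, ?_, rfl⟩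
  · exact e.surjective.comp U.mkQ_surjective
  · rw [LinearMap.ker_comp, LinearEquiv.ker, Submodule.comap_bot, Submodule.ker_mkQ]

theorem SplitHull.isMeek {ι : Type} [Fintype ι] {q : ℕ} {v : ι → Fin q → ℝ} {lam : ι → ℝ}
    {p : Fin q → ℝ} {C P : Set (Fin q → ℝ)} (h : SplitHull v lam p C P)
    [DecidableEq (Fin q → ℝ)] : IsMeek P (Finset.univ.image v) := by
  obtain ⟨d, B, hB⟩ := exists_isBasisPolytope P (Finset.univ.image v)
  refine ⟨d, B, hB, ?_⟩
  rw [h.dim_restComplexSupport, (h.affEquiv_basisPolytope hB).dim_eq h.polytope.convex]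

/-- Affine isomorphisms preserve the decomposition of a polytope as a split hull. -/
theorem SplitHull.map {ι : Type} [Fintype ι] {q r : ℕ} {v : ι → Fin q → ℝ} {lam : ι → ℝ}
    {p : Fin q → ℝ} {C P : Set (Fin q → ℝ)} (h : SplitHull v lam p C P)
    {f : (Fin q → ℝ) →ᵃ[ℝ] (Fin r → ℝ)} {f' : (Fin r → ℝ) →ᵃ[ℝ] (Fin q → ℝ)}
    (hl : ∀ x ∈ P, f' (f x) = x) : SplitHull (f ∘ v) lam (f p) (f '' C) (f '' P) where
  nonneg := h.nonneg
  lt_one := h.lt_one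
  sum_eq_one := h.sum_eq_one
  center_eq := h.apply_center f
  polytope := h.polytope.image f
  center_mem := mem_image_of_mem f h.center_mem
  relint g hg := by
    rintro _ ⟨x, hx, rfl⟩
    exact h.relint (g.comp f) (fun y hy => hg _ (mem_image_of_mem f hy)) x hx
  extend α g hg := by
    obtain ⟨k, hk, hkC⟩ := h.extend α (g.comp f) hg
    refine ⟨k.comp f', fun l => ?_, ?_⟩
    · simp [hl _ (h.point_mem l), hk]
    · rintro _ ⟨x, hx, rfl⟩
      simp [hl _ (h.subset hx), hkC x hx]
  hull := by rw [h.hull, AffineMap.image_convexHull, image_union, range_comp]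

theorem SplitHull.reindex {ι κ : Type} [Fintype ι] [Fintype κ] {q : ℕ} {v : ι → Fin q → ℝ}
    {lam : ι → ℝ} {p : Fin q → ℝ} {C P : Set (Fin q → ℝ)} (h : SplitHull v lam p C P)
    (e : κ ≃ ι) : SplitHull (v ∘ e) (lam ∘ e) p C P where
  nonneg k := h.nonneg (e k)
  lt_one k := h.lt_one (e k)
  sum_eq_one := by rw [← h.sum_eq_one]; exact e.sum_comp lam
  center_eq := by rw [h.center_eq]; exact (e.sum_comp fun k => lam k • v k).symm
  polytope := h.polytope
  center_mem := h.center_mem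
  relint := h.relint
  extend α g hg := by
    obtain ⟨f, hf, hfC⟩ := h.extend (α ∘ e.symm) g (by
      rw [hg, ← e.sum_comp]
      simp)
    exact ⟨f, fun k => by simp [hf], hfC⟩
  hull := by rw [h.hull, range_comp, e.range_eq_univ, image_univ]

/-- Split hulls with the same weights over affinely isomorphic polytopes, with corresponding
centers, are affinely isomorphic. -/
theorem SplitHull.affEquiv {ι : Type} [Fintype ι] {q r : ℕ} {v : ι → Fin q → ℝ} {lam : ι → ℝ}
    {p : Fin q → ℝ} {C P : Set (Fin q → ℝ)} (h : SplitHull v lam p C P)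
    {w : ι → Fin r → ℝ} {p' : Fin r → ℝ} {D R : Set (Fin r → ℝ)} (h' : SplitHull w lam p' D R)
    {φ : (Fin q → ℝ) →ᵃ[ℝ] (Fin r → ℝ)} {ψ : (Fin r → ℝ) →ᵃ[ℝ] (Fin q → ℝ)}
    (hφ : φ '' C = D) (hψ : ∀ x ∈ C, ψ (φ x) = x) (hp : φ p = p') : AffEquiv P R := by
  obtain ⟨f, hf, hfC⟩ := h.extend_pi w φ (by rw [hp, h'.center_eq])
  obtain ⟨f', hf', hfD⟩ := h'.extend_pi v ψ (by rw [← hp, hψ p h.center_mem, h.center_eq])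
  refine AffEquiv.of_inverse (f' := f') f ?_ ?_
  · rw [h.hull, AffineMap.image_convexHull, image_union, ← range_comp, image_congr hfC, hφ, h'.hull]
    congr 2
    exact congrArg range (funext hf)
  · refine h.eqOn_of_forall (f := f'.comp f) (g := AffineMap.id ℝ _) (fun k => ?_) fun x hx => ?_
    · simp [hf, hf']
    · have hx' : φ x ∈ D := hφ ▸ mem_image_of_mem φ hx
      simp [hfC x hx, hfD _ hx', hψ x hx]

/-! ### Interpolation by affine functions -/

section Extension

variable {V : Type*} [AddCommGroup V] [Module ℝ V] {ι : Type} [Fintype ι]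

/-- An affine function can take any prescribed values on an affinely independent family. -/
theorem exists_affineMap_of_affineIndependent {v : ι → V} (hv : AffineIndependent ℝ v)
    (α : ι → ℝ) : ∃ f : V →ᵃ[ℝ] ℝ, ∀ k, f (v k) = α k := by
  classical
  -- Homogenization: affine independence of v is linear independence of the vectors (v k, 1), so a
  -- left inverse of L reads off the weights.
  let L : (ι → ℝ) →ₗ[ℝ] V × ℝ :=
    (Fintype.linearCombination ℝ v).prod (Fintype.linearCombination ℝ fun _ => (1 : ℝ))
  have hL : LinearMap.ker L = ⊥ := by
    rw [LinearMap.ker_eq_bot']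
    intro w hw
    have h1 : ∑ k, w k • v k = 0 := by
      simpa [L, Fintype.linearCombination_apply] using congrArg Prod.fst hw
    have h2 : ∑ k, w k = 0 := by
      simpa [L, Fintype.linearCombination_apply] using congrArg Prod.snd hw
    ext k
    exact (affineIndependent_iff.mp hv) Finset.univ w h2 h1 k (Finset.mem_univ k)
  obtain ⟨g, hg⟩ := LinearMap.exists_leftInverse_of_injective L hL
  refine ⟨((Fintype.linearCombination ℝ α) ∘ₗ g).toAffineMap.comp
    ((AffineMap.id ℝ V).prod (AffineMap.const ℝ V (1 : ℝ))), fun k => ?_⟩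
  have h1 : g (v k, 1) = Pi.single k 1 := by
    have : L (Pi.single k 1) = (v k, 1) := by
      simp [L]
    rw [← this]
    exact LinearMap.congr_fun hg _
  simp [h1]

/-- Compatible values on an affinely independent family and on a set in a complementary
direction can be interpolated by an affine function. -/
theorem exists_affineMap_of_disjoint {v : ι → V} (hv : AffineIndependent ℝ v) {C : Set V}
    (hd : Disjoint (vectorSpan ℝ (range v)) (vectorSpan ℝ C)) {lam : ι → ℝ} (hlam : ∑ k, lam k = 1)
    {p : V} (hp : p = ∑ k, lam k • v k) (hpC : p ∈ affineSpan ℝ C) (α : ι → ℝ) (g : V →ᵃ[ℝ] ℝ)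
    (hg : g p = ∑ k, lam k * α k) :
    ∃ f : V →ᵃ[ℝ] ℝ, (∀ k, f (v k) = α k) ∧ ∀ x ∈ C, f x = g x := by
  obtain ⟨f₁, hf₁⟩ := exists_affineMap_of_affineIndependent hv α
  obtain ⟨U, hU, hc⟩ := hd.exists_isCompl
  let L := LinearMap.ofIsCompl hc (f₁.linear ∘ₗ U.subtype)
    (g.linear ∘ₗ (vectorSpan ℝ C).subtype)
  have hL₁ : ∀ u ∈ vectorSpan ℝ (range v), L u = f₁.linear u := fun u hu =>
    LinearMap.ofIsCompl_apply_left hc ⟨u, hU hu⟩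
  have hL₂ : ∀ u ∈ vectorSpan ℝ C, L u = g.linear u := fun u hu =>
    LinearMap.ofIsCompl_apply_right hc ⟨u, hu⟩
  have hf₁p : f₁ p = g p := by
    rw [hp, affineMap_sum f₁ v hlam, ← hp, hg]
    simp [hf₁]
  refine ⟨L.toAffineMap + AffineMap.const ℝ V (g p - L p), fun k => ?_, fun x hx => ?_⟩
  · have hmem : v k - p ∈ vectorSpan ℝ (range v) := by
      have : v k - p = ∑ l, lam l • (v k - v l) := by
        simp_rw [smul_sub, Finset.sum_sub_distrib, ← Finset.sum_smul, hlam, one_smul, hp]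
      rw [this]
      exact sum_mem fun l _ => Submodule.smul_mem _ _ (vsub_mem_vectorSpan ℝ ⟨k, rfl⟩ ⟨l, rfl⟩)
    have h1 := hL₁ _ hmem
    have h2 := f₁.linearMap_vsub (v k) p
    simp only [vsub_eq_sub] at h2
    rw [h2, hf₁, map_sub, hf₁p] at h1
    simp
    linarith
  · have hmem : x - p ∈ vectorSpan ℝ C := by
      rw [← direction_affineSpan]
      exact AffineSubspace.vsub_mem_direction (subset_affineSpan ℝ C hx) hpC
    have h1 := hL₂ _ hmem
    have h2 := g.linearMap_vsub x p
    simp only [vsub_eq_sub] at h2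
    rw [h2, map_sub] at h1
    simp
    linarith

end Extension

/-! ### From meek polytopes to split hulls -/

section SpecialSimplices

variable {q m : ℕ} {P : Set (Fin q → ℝ)} {s : Finset (Fin q → ℝ)}

/-- Otherwise the zero set is a proper face containing s, and a facet containing that face would
miss no vertex of s. -/
theorem IsSpecialSimplex.eq_zero_of_forall (hs : IsSpecialSimplex m P s) (hP : IsPolytope P)
    (hd : 1 ≤ dim P) {f : (Fin q → ℝ) →ᵃ[ℝ] ℝ} (hf : ∀ x ∈ P, f x ≤ 0) (h0 : ∀ x ∈ s, f x = 0) :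
    ∀ x ∈ P, f x = 0 := by
  by_contra! hne
  obtain ⟨x, hx, hxne⟩ := hne
  obtain ⟨F, hF, hsub, -⟩ := exists_facet_superset hP hd hx (isExposed_zeros hf)
    (fun h => hxne h.2)
  obtain ⟨y, ⟨hy, hyF⟩, -⟩ := hs.2.2.2 F hF
  exact hyF (hsub ⟨(hs.2.1 hy).1, h0 y hy⟩)

/-- Some facet avoids x, and by uniqueness it contains all other vertices of s; take the function
that defines it. -/
theorem IsSpecialSimplex.exists_affineMap (hs : IsSpecialSimplex m P s) (hP : IsPolytope P)
    (hd : 1 ≤ dim P) {x : Fin q → ℝ} (hx : x ∈ s) :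
    ∃ f : (Fin q → ℝ) →ᵃ[ℝ] ℝ, (∀ y ∈ P, f y ≤ 0) ∧ f x < 0 ∧ ∀ y ∈ s, y ≠ x → f y = 0 := by
  have hxP := (hs.2.1 hx).1
  obtain ⟨F, hF, -, hxF⟩ := exists_facet_superset hP hd hxP isExposed_empty (notMem_empty x)
  obtain ⟨f, hf, hFe⟩ := exists_affineMap_of_isExposed hF.1
  refine ⟨f, hf, lt_of_le_of_ne (hf x hxP) fun h0 => hxF (by rw [hFe]; exact ⟨hxP, h0⟩), ?_⟩
  intro y hy hyx
  have hyF : y ∈ F := by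
    by_contra hyF
    exact hyx ((hs.2.2.2 F hF).unique ⟨hy, hyF⟩ ⟨hx, hxF⟩)
  rw [hFe] at hyF
  exact hyF.2

/-- A linear function that is constant on a special simplex and on the set of the remaining
vertices is constant on the polytope. -/
theorem IsSpecialSimplex.constant_of_constant (hs : IsSpecialSimplex m P s) (hP : IsPolytope P)
    (hd : 1 ≤ dim P) (l : (Fin q → ℝ) →ₗ[ℝ] ℝ) (h₁ : ∀ x ∈ s, ∀ y ∈ s, l x = l y)
    (h₂ : ∀ x ∈ P.extremePoints ℝ \ s, ∀ y ∈ P.extremePoints ℝ \ s, l x = l y) :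
    ∀ x ∈ P, ∀ y ∈ P, l x = l y := by
  -- The face where l' is maximal contains a vertex. If that vertex is in s, then l' minus its
  -- maximum vanishes on s and hence on P; otherwise the maximum is attained at a remaining vertex.
  -- This is used for l and -l.
  have key : ∀ l' : (Fin q → ℝ) →ₗ[ℝ] ℝ, (∀ x ∈ s, ∀ y ∈ s, l' x = l' y) →
      (∀ x ∈ P, ∀ y ∈ P, l' x = l' y) ∨ ∃ a ∈ P.extremePoints ℝ \ s, ∀ y ∈ P, l' y ≤ l' a := by
    intro l' hl'
    obtain ⟨a, ha, hmax⟩ := hP.exists_isMaxOn l'.toAffineMap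
    let f : (Fin q → ℝ) →ᵃ[ℝ] ℝ := l'.toAffineMap - AffineMap.const ℝ _ (l' a)
    have hfe : ∀ x, f x = l' x - l' a := fun x => by simp [f]
    have hf : ∀ x ∈ P, f x ≤ 0 := fun x hx => by
      rw [hfe]
      exact sub_nonpos.mpr (hmax x hx)
    obtain ⟨b, ⟨hbP, hb0⟩, hbe⟩ := hP.exists_extremePoint_mem (isExposed_zeros hf)
      ⟨a, ha, by rw [hfe, sub_self]⟩
    rw [hfe, sub_eq_zero] at hb0
    by_cases hbs : b ∈ s
    · left
      have := hs.eq_zero_of_forall hP hd hf fun x hx => by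
        rw [hfe, hl' x hx b hbs, hb0, sub_self]
      intro x hx y hy
      have h1 := this x hx
      have h2 := this y hy
      rw [hfe] at h1 h2
      linarith
    · exact Or.inr ⟨b, ⟨hbe, hbs⟩, fun y hy => by rw [hb0]; exact hmax y hy⟩
  rcases key l h₁ with h | ⟨a, ha, hamax⟩
  · exact h
  rcases key (-l) (fun x hx y hy => by simp [h₁ x hx y hy]) with h | ⟨b, hb, hbmax⟩
  · intro x hx y hy
    simpa using h x hx y hy
  have hab := h₂ a ha b hb
  intro x hx y hy
  have h1 := hamax x hx
  have h2 := hamax y hy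
  have h3 := hbmax x hx
  have h4 := hbmax y hy
  simp only [LinearMap.neg_apply, neg_le_neg_iff] at h3 h4
  linarith

theorem vectorSpan_convexHull (A : Set (Fin q → ℝ)) :
    vectorSpan ℝ (convexHull ℝ A) = vectorSpan ℝ A := by
  rw [← direction_affineSpan, affineSpan_convexHull, direction_affineSpan]

/-- A meek polytope is the split hull of its special simplex and its remaining vertices. -/
theorem IsSpecialSimplex.exists_splitHull (hs : IsSpecialSimplex m P s) (hP : IsPolytope P)
    (hd : m < dim P) (hmeek : IsMeek P s) :
    ∃ (lam : s → ℝ) (p : Fin q → ℝ) (C : Set (Fin q → ℝ)),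
      SplitHull (fun k : s => (k : Fin q → ℝ)) lam p C P := by
  have hd1 : 1 ≤ dim P := by omega
  have hrange : range (fun k : s => (k : Fin q → ℝ)) = s := by simp
  set A := P.extremePoints ℝ \ (s : Set (Fin q → ℝ)) with hA
  have hAfin : A.Finite := hP.finite_extremePoints.subset sdiff_subset
  have hVA := vectorSpan_convexHull A
  have hV₁ : Module.finrank ℝ (vectorSpan ℝ (s : Set (Fin q → ℝ))) = m := by
    rw [← hrange]
    exact hs.2.2.1.finrank_vectorSpan (by rw [Fintype.card_coe]; exact hs.1)
  have hsup : vectorSpan ℝ P ≤ vectorSpan ℝ (s : Set (Fin q → ℝ)) ⊔ vectorSpan ℝ A := by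
    intro u hu
    by_contra hn
    obtain ⟨l, hl, hle⟩ := Submodule.exists_le_ker_of_notMem hn
    have hker : ∀ B : Set (Fin q → ℝ), vectorSpan ℝ B ≤ LinearMap.ker l →
        ∀ x ∈ B, ∀ y ∈ B, l x = l y := fun B hB x hx y hy => by
      have := hB (vsub_mem_vectorSpan ℝ hx hy)
      rwa [LinearMap.mem_ker, vsub_eq_sub, map_sub, sub_eq_zero] at this
    have hc := hs.constant_of_constant hP hd1 l (hker _ (le_sup_left.trans hle))
      (hker _ (le_sup_right.trans hle))
    have : vectorSpan ℝ P ≤ LinearMap.ker l := by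
      rw [vectorSpan_le_iff]
      intro x hx y hy
      rw [LinearMap.mem_ker, map_sub, hc x hx y hy, sub_self]
    exact hl (this hu)
  -- Each remaining vertex is itself a face avoiding s, so meekness gives dim A ≤ dim π(P). But π
  -- maps the directions of A onto those of π(P), because it kills those of s; by rank–nullity it is
  -- injective on the directions of A.
  have hdisj : Disjoint (vectorSpan ℝ (s : Set (Fin q → ℝ))) (vectorSpan ℝ A) := by
    obtain ⟨d, Q, ⟨π, -, hker, rfl⟩, hdim⟩ := hmeek
    have hAR : A ⊆ restComplexSupport P s := fun x hx =>
      ⟨{x}, ⟨hP.isExposed_singleton hx.1, disjoint_singleton_left.mpr hx.2⟩, rfl⟩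
    have h1 : Module.finrank ℝ (vectorSpan ℝ A) ≤ dim (restComplexSupport P s) :=
      Submodule.finrank_mono (vectorSpan_mono ℝ hAR)
    have h2 : vectorSpan ℝ (π '' P) ≤ (vectorSpan ℝ A).map π := by
      have h3 : vectorSpan ℝ (π '' P) = (vectorSpan ℝ P).map π :=
        (AffineMap.map_vectorSpan π.toAffineMap).symm
      rw [h3]
      refine (Submodule.map_mono hsup).trans ?_
      rw [Submodule.map_sup, ← hker]
      refine sup_le ?_ le_rfl
      rintro _ ⟨u, hu, rfl⟩
      rw [LinearMap.mem_ker.mp hu]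
      exact zero_mem _
    have h4 := Submodule.finrank_mono h2
    have h5 := LinearMap.finrank_range_add_finrank_ker (π ∘ₗ (vectorSpan ℝ A).subtype)
    rw [LinearMap.range_comp, Submodule.range_subtype] at h5
    unfold dim at hdim h1
    have h6 : Module.finrank ℝ (LinearMap.ker (π ∘ₗ (vectorSpan ℝ A).subtype)) = 0 := by omega
    rw [Submodule.finrank_eq_zero, LinearMap.ker_eq_bot'] at h6
    rw [Submodule.disjoint_def, ← hker]
    intro u hu huA
    exact congrArg Subtype.val (h6 ⟨u, huA⟩ hu)
  have hAne : A.Nonempty := by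
    rw [nonempty_iff_ne_empty]
    intro h0
    rw [h0, vectorSpan_empty, sup_bot_eq] at hsup
    have := Submodule.finrank_mono hsup
    unfold dim at hd
    omega
  obtain ⟨c, hc⟩ := hAne
  obtain ⟨σ, hσ⟩ : s.Nonempty := by
    rw [← Finset.card_pos, hs.1]
    omega
  -- Decompose σ - c for a vertex σ of s and a remaining vertex c: the point c + u₂ = σ - u₁ lies in
  -- both affine hulls.
  obtain ⟨u₁, hu₁, u₂, hu₂, hu⟩ := Submodule.mem_sup.mp
    (hsup (vsub_mem_vectorSpan ℝ (hs.2.1 hσ).1 hc.1.1))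
  have hp₁ : c + u₂ ∈ affineSpan ℝ (s : Set (Fin q → ℝ)) := by
    have : c + u₂ = (-u₁) +ᵥ σ := by
      rw [vsub_eq_sub] at hu
      rw [vadd_eq_add, ← sub_add_cancel σ c, ← hu]
      abel
    rw [this]
    exact AffineSubspace.vadd_mem_of_mem_direction
      (by rw [direction_affineSpan]; exact neg_mem hu₁) (subset_affineSpan ℝ _ hσ)
  have hp₂ : c + u₂ ∈ affineSpan ℝ (convexHull ℝ A) := by
    rw [affineSpan_convexHull, add_comm]
    exact AffineSubspace.vadd_mem_of_mem_direction
      (by rw [direction_affineSpan]; exact hu₂) (subset_affineSpan ℝ _ hc)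
  set p := c + u₂
  rw [← hrange] at hp₁
  obtain ⟨lam, hlam, hp⟩ := eq_affineCombination_of_mem_affineSpan_of_fintype hp₁
  rw [Finset.affineCombination_eq_linear_combination _ _ _ hlam] at hp
  have hext := exists_affineMap_of_disjoint (V := Fin q → ℝ) (C := convexHull ℝ A) hs.2.2.1
    (by rwa [hrange, hVA]) hlam hp hp₂
  have hhull : P = convexHull ℝ (range (fun k : s => (k : Fin q → ℝ)) ∪ convexHull ℝ A) := by
    rw [convexHull_convexHull_union_right, hrange, hA, union_sdiff_cancel hs.2.1,
      hP.convexHull_extremePoints]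
  have hsubP : convexHull ℝ A ⊆ P := convexHull_min (fun x hx => hx.1.1) hP.convex
  have hrel : ∀ g : (Fin q → ℝ) →ᵃ[ℝ] ℝ, (∀ x ∈ convexHull ℝ A, g x ≤ g p) →
      ∀ x ∈ convexHull ℝ A, g x = g p := by
    intro g hg
    -- Extending g - g p by zero on s gives a nonpositive function on P vanishing on s, hence on P.
    obtain ⟨f, hf, hfC⟩ := hext (fun _ => 0) (g - AffineMap.const ℝ _ (g p)) (by simp)
    simp only [AffineMap.coe_sub, Pi.sub_apply, AffineMap.const_apply] at hfC
    have hle : ∀ x ∈ P, f x ≤ 0 := by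
      rw [hhull]
      apply affineMap_le_on_convexHull
      rintro x (⟨k, rfl⟩ | hx)
      · exact (hf k).le
      · rw [hfC x hx]
        exact sub_nonpos.mpr (hg x hx)
    have h0 := hs.eq_zero_of_forall hP hd1 hle fun x hx => hf ⟨x, hx⟩
    intro x hx
    have := h0 x (hsubP hx)
    rwa [hfC x hx, sub_eq_zero] at this
  have hpC : p ∈ convexHull ℝ A :=
    intrinsicInterior_subset (mem_intrinsicInterior_of_forall (convex_convexHull ℝ A) hp₂ hrel)
  have hnn : ∀ k, 0 ≤ lam k := by
    intro k
    obtain ⟨f, hf, hfk, hf0⟩ := hs.exists_affineMap hP hd1 k.2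
    -- Only the vertex k contributes; since f p ≤ 0 and f k < 0, the weight cannot be negative.
    have h1 : f p = lam k * f k := by
      rw [hp, affineMap_sum f _ hlam, Finset.sum_eq_single k]
      · rfl
      · intro l _ hl
        rw [hf0 l l.2 fun h => hl (Subtype.ext h), smul_zero]
      · exact fun h => absurd (Finset.mem_univ k) h
    have h2 := hf p (hsubP hpC)
    rw [h1] at h2
    by_contra hneg
    exact absurd (mul_pos_of_neg_of_neg (not_le.mp hneg) hfk) (not_lt.mpr h2)
  refine ⟨lam, p, convexHull ℝ A, ?_⟩
  refine ⟨hnn, ?_, hlam, hp, ?_, hpC, hrel, hext, hhull⟩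
  · intro k
    -- A weight of at least 1 would leave nothing for the others, so p would be the vertex k, which
    -- is impossible in the hull of the remaining vertices.
    by_contra hk
    have hsplit := Finset.add_sum_erase Finset.univ lam (Finset.mem_univ k)
    have hge := Finset.sum_nonneg (s := Finset.univ.erase k) fun l _ => hnn l
    have hz : ∑ l ∈ Finset.univ.erase k, lam l = 0 := by linarith
    have hz' := (Finset.sum_eq_zero_iff_of_nonneg fun l _ => hnn l).mp hz
    have hpk : p = k := by
      rw [hp, Finset.sum_eq_single k]
      · have : lam k = 1 := by linarith
        rw [this, one_smul]
      · intro l _ hl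
        rw [hz' l (Finset.mem_erase.mpr ⟨hl, Finset.mem_univ l⟩), zero_smul]
      · exact fun h => absurd (Finset.mem_univ k) h
    rw [hpk] at hpC
    refine (hP.convex.mem_extremePoints_iff_mem_sdiff_convexHull_sdiff.mp (hs.2.1 k.2)).2
      (convexHull_mono ?_ hpC)
    exact fun x hx => ⟨hx.1.1, fun h => hx.2 (h ▸ k.2)⟩
  · exact ⟨hAfin.toFinset, ⟨c, hAfin.mem_toFinset.mpr hc⟩, by rw [hAfin.coe_toFinset]⟩

end SpecialSimplices

/-! ### Pyramids over split hulls -/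

section Pyramids

/-- The inclusion of `ℝᵈ` as the base hyperplane of `ℝᵈ⁺¹`. -/
def snocZero (d : ℕ) : (Fin d → ℝ) →ₗ[ℝ] (Fin (d + 1) → ℝ) where
  toFun x := Fin.snoc (α := fun _ => ℝ) x 0
  map_add' x y := by
    ext k
    refine Fin.lastCases ?_ (fun k => ?_) k <;> simp
  map_smul' c x := by
    ext k
    refine Fin.lastCases ?_ (fun k => ?_) k <;> simp

theorem snocZero_apply {d : ℕ} (x : Fin d → ℝ) :
    snocZero d x = Fin.snoc (α := fun _ => ℝ) x 0 := rfl

theorem funLeft_castSucc_snoc {d : ℕ} (x : Fin d → ℝ) (a : ℝ) :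
    LinearMap.funLeft ℝ ℝ Fin.castSucc (Fin.snoc (α := fun _ => ℝ) x a : Fin (d + 1) → ℝ) = x := by
  ext k
  simp [LinearMap.funLeft_apply]

variable {ι : Type} [Fintype ι] {d : ℕ} {v : ι → Fin d → ℝ} {lam : ι → ℝ} {p : Fin d → ℝ}
  {C K : Set (Fin d → ℝ)}

/-- The apex enters as a new point of weight 0, so the center and C are merely carried into the base
hyperplane. -/
theorem SplitHull.pyr (h : SplitHull v lam p C K) :
    SplitHull (fun o : Option ι => o.elim (Fin.snoc (α := fun _ => ℝ) (0 : Fin d → ℝ) 1)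
      fun k => snocZero d (v k)) (fun o => o.elim 0 lam) (snocZero d p) (snocZero d '' C)
      (pyr K) where
  nonneg k := by cases k <;> simp [h.nonneg]
  lt_one k := by cases k <;> simp [h.lt_one]
  sum_eq_one := by simp [Fintype.sum_option, h.sum_eq_one]
  center_eq := by simp [Fintype.sum_option, h.center_eq]
  polytope := h.polytope.image (snocZero d).toAffineMap
  center_mem := mem_image_of_mem _ h.center_mem
  relint g hg := by
    rintro _ ⟨x, hx, rfl⟩
    exact h.relint (g.comp (snocZero d).toAffineMap) (fun y hy => hg _ (mem_image_of_mem _ hy)) x hx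
  extend α g hg := by
    obtain ⟨f, hf, hfC⟩ := h.extend (fun k => α (some k)) (g.comp (snocZero d).toAffineMap) (by
      simpa [Fintype.sum_option] using hg)
    -- The slope in the last coordinate is chosen to give the value α none at the apex (0, 1); the
    -- base is unaffected.
    let f' : (Fin (d + 1) → ℝ) →ᵃ[ℝ] ℝ := f.comp (LinearMap.funLeft ℝ ℝ Fin.castSucc).toAffineMap +
      (α none - f 0) • (LinearMap.proj (Fin.last d) : (Fin (d + 1) → ℝ) →ₗ[ℝ] ℝ).toAffineMap
    have hf' : ∀ x a, f' (Fin.snoc (α := fun _ => ℝ) x a) = f x + (α none - f 0) * a := by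
      intro x a
      simp [f', funLeft_castSucc_snoc]
    refine ⟨f', fun k => ?_, ?_⟩
    · cases k with
      | none => simp [hf']
      | some k => simp [snocZero_apply, hf', hf]
    · rintro _ ⟨x, hx, rfl⟩
      have := hfC x hx
      simp only [AffineMap.coe_comp, Function.comp_apply, LinearMap.coe_toAffineMap] at this
      rw [← this, snocZero_apply, hf', mul_zero, add_zero]
  hull := by
    have h1 : (fun x : Fin d → ℝ => (Fin.snoc (α := fun _ => ℝ) x 0 : Fin (d + 1) → ℝ)) '' K =
        convexHull ℝ (snocZero d '' (range v ∪ C)) := by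
      rw [h.hull]
      exact AffineMap.image_convexHull (snocZero d).toAffineMap _
    rw [SpecialSimplex.pyr, h1, insert_eq, convexHull_convexHull_union_right, image_union,
      ← union_assoc]
    congr 2
    ext x
    simp only [mem_union, mem_singleton_iff, mem_image, mem_range, Option.exists, Option.elim_none,
      Option.elim_some]
    constructor
    · rintro (rfl | ⟨_, ⟨k, rfl⟩, rfl⟩)
      exacts [Or.inl rfl, Or.inr ⟨k, rfl⟩]
    · rintro (rfl | ⟨k, rfl⟩)
      exacts [Or.inl rfl, Or.inr ⟨_, ⟨k, rfl⟩, rfl⟩]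

theorem SplitHull.pyrIter (h : SplitHull v lam p C K) (i : ℕ) :
    ∃ (w : ι ⊕ Fin i → Fin (d + i) → ℝ) (A : (Fin d → ℝ) →ᵃ[ℝ] (Fin (d + i) → ℝ))
      (A' : (Fin (d + i) → ℝ) →ᵃ[ℝ] (Fin d → ℝ)), (∀ x, A' (A x) = x) ∧
      SplitHull w (Sum.elim lam 0) (A p) (A '' C) (pyrIter K i) := by
  induction i with
  | zero =>
    refine ⟨v ∘ Equiv.sumEmpty ι (Fin 0), AffineMap.id ℝ _, AffineMap.id ℝ _, fun x => rfl, ?_⟩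
    have h1 := h.reindex (Equiv.sumEmpty ι (Fin 0))
    have h2 : lam ∘ (Equiv.sumEmpty ι (Fin 0)) = Sum.elim lam 0 := by
      ext k
      rcases k with k | k
      · rfl
      · exact k.elim0
    rw [h2] at h1
    have h3 : (AffineMap.id ℝ (Fin d → ℝ)) '' C = C := image_id C
    rw [h3]
    exact h1
  | succ i ih =>
    obtain ⟨w, A, A', hA, hw⟩ := ih
    -- The newest apex, `none`, becomes the last index of `Fin (i + 1)`.
    let e : ι ⊕ Fin (i + 1) ≃ Option (ι ⊕ Fin i) :=
      ((Equiv.sumCongr (Equiv.refl ι)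
        (finSuccEquivLast.trans (Equiv.optionEquivSumPUnit.{0} (Fin i)))).trans
        (Equiv.sumAssoc ι (Fin i) PUnit).symm).trans (Equiv.optionEquivSumPUnit _).symm
    have h1 := hw.pyr.reindex e
    refine ⟨(fun o : Option (ι ⊕ Fin i) =>
      o.elim (Fin.snoc (α := fun _ => ℝ) (0 : Fin (d + i) → ℝ) 1)
      fun k => snocZero (d + i) (w k)) ∘ e, (snocZero (d + i)).toAffineMap.comp A,
      A'.comp (LinearMap.funLeft ℝ ℝ Fin.castSucc).toAffineMap, fun x => ?_, ?_⟩
    · simp [snocZero_apply, funLeft_castSucc_snoc, hA]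
    · have h2 : (fun o : Option (ι ⊕ Fin i) => o.elim 0 (Sum.elim lam 0)) ∘ e =
          Sum.elim lam 0 := by
        ext k
        rcases k with k | k
        · simp [e]
        · refine Fin.lastCases ?_ (fun k => ?_) k <;> simp [e]
      rw [h2] at h1
      rw [AffineMap.coe_comp, image_comp]
      exact h1

end Pyramids

/-! ### Direct sums with a simplex -/

section DirectSums

/-- The inclusion of the first factor of `ℝᵃ⁺ᵇ`. -/
def appendZero (a b : ℕ) : (Fin a → ℝ) →ₗ[ℝ] (Fin (a + b) → ℝ) where
  toFun x := Fin.append x 0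
  map_add' x y := by
    ext k
    refine Fin.addCases (fun k => ?_) (fun k => ?_) k <;> simp
  map_smul' c x := by
    ext k
    refine Fin.addCases (fun k => ?_) (fun k => ?_) k <;> simp

/-- The inclusion of the second factor of `ℝᵃ⁺ᵇ`. -/
def zeroAppend (a b : ℕ) : (Fin b → ℝ) →ₗ[ℝ] (Fin (a + b) → ℝ) where
  toFun x := Fin.append 0 x
  map_add' x y := by
    ext k
    refine Fin.addCases (fun k => ?_) (fun k => ?_) k <;> simp
  map_smul' c x := by
    ext k
    refine Fin.addCases (fun k => ?_) (fun k => ?_) k <;> simp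

theorem append_eq_add {a b : ℕ} (x : Fin a → ℝ) (y : Fin b → ℝ) :
    Fin.append x y = appendZero a b x + zeroAppend a b y := by
  ext k
  refine Fin.addCases (fun k => ?_) (fun k => ?_) k <;> simp [appendZero, zeroAppend]

theorem funLeft_castAdd_appendZero {a b : ℕ} (x : Fin a → ℝ) :
    LinearMap.funLeft ℝ ℝ (Fin.castAdd b) (appendZero a b x) = x := by
  ext k
  simp [LinearMap.funLeft_apply, appendZero]

theorem funLeft_natAdd_appendZero {a b : ℕ} (x : Fin a → ℝ) :
    LinearMap.funLeft ℝ ℝ (Fin.natAdd a) (appendZero a b x) = 0 := by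
  ext k
  simp [LinearMap.funLeft_apply, appendZero]

theorem funLeft_castAdd_zeroAppend {a b : ℕ} (x : Fin b → ℝ) :
    LinearMap.funLeft ℝ ℝ (Fin.castAdd b) (zeroAppend a b x) = 0 := by
  ext k
  simp [LinearMap.funLeft_apply, zeroAppend]

theorem funLeft_natAdd_zeroAppend {a b : ℕ} (x : Fin b → ℝ) :
    LinearMap.funLeft ℝ ℝ (Fin.natAdd a) (zeroAppend a b x) = x := by
  ext k
  simp [LinearMap.funLeft_apply, zeroAppend]

theorem directSum_eq_convexHull {a b : ℕ} {S : Set (Fin a → ℝ)} {Q : Set (Fin b → ℝ)}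
    (hS : Convex ℝ S) (hSne : S.Nonempty) (hQ : Convex ℝ Q) (hQ0 : (0 : Fin b → ℝ) ∈ Q) :
    directSum S Q = convexHull ℝ (appendZero a b '' S ∪ zeroAppend a b '' Q) := by
  apply Subset.antisymm
  · rintro _ ⟨x, hx, y, hy, l₁, l₂, h₁, h₂, hl, rfl⟩
    have hmem : ∀ i : Fin 3, ![appendZero a b x, zeroAppend a b y, 0] i ∈
        convexHull ℝ (appendZero a b '' S ∪ zeroAppend a b '' Q) := by
      intro i
      apply subset_convexHull
      fin_cases i
      · exact Or.inl ⟨x, hx, rfl⟩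
      · exact Or.inr ⟨y, hy, rfl⟩
      · exact Or.inr ⟨0, hQ0, by simp⟩
    -- The slack 1 - l₁ - l₂ is put on the origin, which lies in Q.
    have := (convex_convexHull ℝ _).sum_mem (t := Finset.univ) (w := ![l₁, l₂, 1 - l₁ - l₂])
      (fun i _ => by fin_cases i <;> simp <;> linarith) (by simp [Fin.sum_univ_three])
      fun i _ => hmem i
    simpa [Fin.sum_univ_three, append_eq_add] using this
  · have hQne : Q.Nonempty := ⟨0, hQ0⟩
    rw [convexHull_union (hSne.image _) (hQne.image _),
      (hS.linear_image _).convexHull_eq, (hQ.linear_image _).convexHull_eq]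
    intro z hz
    rw [mem_convexJoin] at hz
    obtain ⟨_, ⟨x, hx, rfl⟩, _, ⟨y, hy, rfl⟩, l₁, l₂, h₁, h₂, hl, rfl⟩ := hz
    exact ⟨x, hx, y, hy, l₁, l₂, h₁, h₂, hl.le, by rw [append_eq_add, map_smul, map_smul]⟩

/-- After the translations by b and c, simplex and Q meet exactly at the origin, which serves as
center. Since j > 0 there are at least two positive weights, so each is below 1. -/
theorem splitHull_directSum {j d : ℕ} (hj : 0 < j) {w : Fin (j + 1) → Fin j → ℝ}
    (hw : AffineIndependent ℝ w) {lam : Fin (j + 1) → ℝ} (hpos : ∀ k, 0 < lam k)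
    (hsum : ∑ k, lam k = 1) {Q : Set (Fin d → ℝ)} (hQ : IsPolytope Q) {b : Fin j → ℝ}
    (hb : b = ∑ k, lam k • w k) {c : Fin d → ℝ} (hc : c ∈ intrinsicInterior ℝ Q) :
    ∃ (v : Fin (j + 1) → Fin (j + d) → ℝ) (A : (Fin d → ℝ) →ᵃ[ℝ] (Fin (j + d) → ℝ))
      (A' : (Fin (j + d) → ℝ) →ᵃ[ℝ] (Fin d → ℝ)), (∀ x, A' (A x) = x) ∧
      SplitHull v lam (A c) (A '' Q) (directSum ((fun x => x - b) '' convexHull ℝ (range w))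
        ((fun x => x - c) '' Q)) := by
  have hcQ := intrinsicInterior_subset hc
  let A : (Fin d → ℝ) →ᵃ[ℝ] (Fin (j + d) → ℝ) :=
    (zeroAppend j d).toAffineMap.comp (AffineMap.id ℝ _ - AffineMap.const ℝ _ c)
  let A' : (Fin (j + d) → ℝ) →ᵃ[ℝ] (Fin d → ℝ) :=
    (LinearMap.funLeft ℝ ℝ (Fin.natAdd j)).toAffineMap + AffineMap.const ℝ _ c
  have hA : ∀ x, A x = zeroAppend j d (x - c) := fun x => by simp [A]
  have hAc : A c = 0 := by rw [hA, sub_self, map_zero]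
  refine ⟨fun k => appendZero j d (w k - b), A, A', fun x => ?_, ?_⟩
  · rw [hA]
    simp [A', funLeft_natAdd_zeroAppend]
  refine ⟨fun k => (hpos k).le, fun k => ?_, hsum, ?_, hQ.image A, mem_image_of_mem A hcQ, ?_, ?_,
    ?_⟩
  · obtain ⟨l, hl⟩ : ∃ l : Fin (j + 1), l ≠ k := by
      have : Nontrivial (Fin (j + 1)) := Fin.nontrivial_iff_two_le.mpr (by omega)
      exact exists_ne k
    have h1 := Finset.add_sum_erase Finset.univ lam (Finset.mem_univ k)
    have h2 : 0 < ∑ l ∈ Finset.univ.erase k, lam l :=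
      Finset.sum_pos (fun l _ => hpos l) ⟨l, Finset.mem_erase.mpr ⟨hl, Finset.mem_univ l⟩⟩
    linarith
  · have : ∑ k, lam k • appendZero j d (w k - b) = appendZero j d (∑ k, lam k • (w k - b)) := by
      rw [map_sum]
      simp_rw [map_smul]
    rw [hAc, this]
    simp_rw [smul_sub, Finset.sum_sub_distrib, ← Finset.sum_smul, hsum, one_smul, ← hb, sub_self,
      map_zero]
  · intro g hg
    rintro _ ⟨x, hx, rfl⟩
    exact eq_of_le_of_mem_intrinsicInterior (g := g.comp A) hc
      (fun y hy => hg _ (mem_image_of_mem A hy)) x hx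
  · intro α g hg
    obtain ⟨f, hf⟩ := exists_affineMap_of_affineIndependent hw α
    have hfb : f b = g 0 := by
      rw [hb, affineMap_sum f w hsum, ← hAc, hg]
      simp [hf]
    -- Add the prescription on each factor and subtract the common value f b = g 0 at the origin,
    -- which is counted twice.
    let f' : (Fin (j + d) → ℝ) →ᵃ[ℝ] ℝ :=
      f.comp ((LinearMap.funLeft ℝ ℝ (Fin.castAdd d)).toAffineMap + AffineMap.const ℝ _ b) +
        g.comp ((zeroAppend j d) ∘ₗ (LinearMap.funLeft ℝ ℝ (Fin.natAdd j))).toAffineMap -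
        AffineMap.const ℝ _ (g 0)
    refine ⟨f', fun k => ?_, ?_⟩
    · simp [f', -map_sub, funLeft_castAdd_appendZero, funLeft_natAdd_appendZero, hf]
    · rintro _ ⟨x, hx, rfl⟩
      rw [hA]
      simp [f', -map_sub, funLeft_castAdd_zeroAppend, funLeft_natAdd_zeroAppend, hfb]
  · have hS : (fun x => x - b) '' convexHull ℝ (range w) =
        convexHull ℝ ((fun x => x - b) '' range w) :=
      AffineMap.image_convexHull (AffineMap.id ℝ _ - AffineMap.const ℝ _ b) (range w)
    have hQc : Convex ℝ ((fun x => x - c) '' Q) :=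
      hQ.convex.affine_image (AffineMap.id ℝ _ - AffineMap.const ℝ _ c)
    rw [hS, directSum_eq_convexHull (convex_convexHull ℝ _)
      ((range_nonempty w).image _).convexHull hQc ⟨c, hcQ, sub_self c⟩]
    have h1 : appendZero j d '' convexHull ℝ ((fun x => x - b) '' range w) =
        convexHull ℝ (appendZero j d '' ((fun x => x - b) '' range w)) :=
      AffineMap.image_convexHull (appendZero j d).toAffineMap _
    rw [h1, convexHull_convexHull_union_left]
    congr 2
    · rw [image_image, ← range_comp]
      rfl
    · rw [image_image]
      exact image_congr fun x _ => (hA x).symm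

theorem splitHull_pyrIter_directSum (i : ℕ) {j d : ℕ} (hj : 0 < j) {w : Fin (j + 1) → Fin j → ℝ}
    (hw : AffineIndependent ℝ w) {lam : Fin (j + 1) → ℝ} (hpos : ∀ k, 0 < lam k)
    (hsum : ∑ k, lam k = 1) {Q : Set (Fin d → ℝ)} (hQ : IsPolytope Q) {b : Fin j → ℝ}
    (hb : b = ∑ k, lam k • w k) {c : Fin d → ℝ} (hc : c ∈ intrinsicInterior ℝ Q) :
    ∃ (v : Fin (j + 1) ⊕ Fin i → Fin (j + d + i) → ℝ)
      (A : (Fin d → ℝ) →ᵃ[ℝ] (Fin (j + d + i) → ℝ))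
      (A' : (Fin (j + d + i) → ℝ) →ᵃ[ℝ] (Fin d → ℝ)), (∀ x, A' (A x) = x) ∧
      SplitHull v (Sum.elim lam 0) (A c) (A '' Q)
        (pyrIter (directSum ((fun x => x - b) '' convexHull ℝ (range w))
          ((fun x => x - c) '' Q)) i) := by
  obtain ⟨v, A, A', hA, h⟩ := splitHull_directSum hj hw hpos hsum hQ hb hc
  obtain ⟨v', B, B', hB, h'⟩ := h.pyrIter i
  refine ⟨v', B.comp A, A'.comp B', fun x => by simp [hA, hB], ?_⟩
  rw [AffineMap.coe_comp, image_comp]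
  exact h'

end DirectSums

/-! ### Passing between pyramids over direct sums and split hulls -/

section PyramidsOverSums

variable {i j d : ℕ} {Q : Set (Fin d → ℝ)}

theorem IsPyramidOverSum.exists_splitHull {R : Set (Fin (j + d + i) → ℝ)}
    (h : IsPyramidOverSum i j Q R) (hj : 0 < j) (hQ : IsPolytope Q) :
    ∃ (lam : Fin (j + 1) → ℝ) (c : Fin d → ℝ) (v : Fin (j + 1) ⊕ Fin i → Fin (j + d + i) → ℝ)
      (A : (Fin d → ℝ) →ᵃ[ℝ] (Fin (j + d + i) → ℝ))
      (A' : (Fin (j + d + i) → ℝ) →ᵃ[ℝ] (Fin d → ℝ)), (∀ k, 0 < lam k) ∧ (∀ x, A' (A x) = x) ∧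
      SplitHull v (Sum.elim lam 0) (A c) (A '' Q) R := by
  obtain ⟨S, b, c, ⟨w, hw, rfl⟩, hb, hc, rfl⟩ := h
  have hbS := convexHull_subset_affineSpan (𝕜 := ℝ) _ (intrinsicInterior_subset hb)
  obtain ⟨lam, hsum, hbe⟩ := eq_affineCombination_of_mem_affineSpan_of_fintype hbS
  rw [Finset.affineCombination_eq_linear_combination _ _ _ hsum] at hbe
  have hpos : ∀ k, 0 < lam k := by
    intro k
    -- The negated k-th barycentric coordinate: if lam k ≤ 0, it would be maximal over the simplex
    -- at b, hence constant, forcing lam k = 1.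
    obtain ⟨f, hf⟩ := exists_affineMap_of_affineIndependent hw (-Pi.single k 1)
    have hfb : f b = -lam k := by
      rw [hbe, affineMap_sum f w hsum]
      simp [hf, Pi.single_apply]
    by_contra hk
    have hle : ∀ x ∈ convexHull ℝ (range w), f x ≤ f b := by
      apply affineMap_le_on_convexHull
      rintro _ ⟨l, rfl⟩
      rw [hf, hfb]
      simp only [Pi.neg_apply, Pi.single_apply]
      split_ifs <;> linarith
    have := eq_of_le_of_mem_intrinsicInterior hb hle (w k) (subset_convexHull ℝ _ ⟨k, rfl⟩)
    rw [hf, hfb] at this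
    simp only [Pi.neg_apply, Pi.single_eq_same, neg_inj] at this
    linarith
  obtain ⟨v, A, A', hA, h⟩ := splitHull_pyrIter_directSum i hj hw hpos hsum hQ hbe hc
  exact ⟨lam, c, v, A, A', hpos, hA, h⟩

/-- Any positive weights can be realized: translate a simplex by the corresponding weighted mean of
its vertices. That mean is relatively interior, since a function maximal there must take the same
value at every vertex. -/
theorem exists_isPyramidOverSum (i : ℕ) (hj : 0 < j) (hQ : IsPolytope Q) {lam : Fin (j + 1) → ℝ}
    (hpos : ∀ k, 0 < lam k) (hsum : ∑ k, lam k = 1) {c : Fin d → ℝ}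
    (hc : c ∈ intrinsicInterior ℝ Q) :
    ∃ (R : Set (Fin (j + d + i) → ℝ)) (v : Fin (j + 1) ⊕ Fin i → Fin (j + d + i) → ℝ)
      (A : (Fin d → ℝ) →ᵃ[ℝ] (Fin (j + d + i) → ℝ))
      (A' : (Fin (j + d + i) → ℝ) →ᵃ[ℝ] (Fin d → ℝ)), IsPyramidOverSum i j Q R ∧
      (∀ x, A' (A x) = x) ∧ SplitHull v (Sum.elim lam 0) (A c) (A '' Q) R := by
  obtain ⟨w, hw⟩ : ∃ w : Fin (j + 1) → Fin j → ℝ, AffineIndependent ℝ w := by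
    obtain ⟨B⟩ := AffineBasis.exists_affineBasis_of_finiteDimensional (k := ℝ)
      (P := Fin j → ℝ) (ι := Fin (j + 1)) (by simp)
    exact ⟨B, B.ind⟩
  obtain ⟨v, A, A', hA, h⟩ := splitHull_pyrIter_directSum i hj hw hpos hsum hQ rfl hc
  refine ⟨_, v, A, A', ⟨_, _, c, ⟨w, hw, rfl⟩, ?_, hc, rfl⟩, hA, h⟩
  have hmem : ∑ k, lam k • w k ∈ convexHull ℝ (range w) :=
    (convex_convexHull ℝ _).sum_mem (fun k _ => (hpos k).le) hsum
      fun k _ => subset_convexHull ℝ _ ⟨k, rfl⟩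
  refine mem_intrinsicInterior_of_forall (convex_convexHull ℝ _) (subset_affineSpan ℝ _ hmem) ?_
  intro g hg
  have hgs := affineMap_sum g w hsum
  set y := g (∑ k, lam k • w k) with hy
  have hz : ∑ k, lam k * (y - g (w k)) = 0 := by
    simp only [smul_eq_mul] at hgs
    simp_rw [mul_sub, Finset.sum_sub_distrib, ← Finset.sum_mul, hsum, one_mul, ← hgs, sub_self]
  have hle : ∀ k, 0 ≤ y - g (w k) := fun k =>
    sub_nonneg.mpr (hg _ (subset_convexHull ℝ _ ⟨k, rfl⟩))
  have hz' := (Finset.sum_eq_zero_iff_of_nonneg fun k _ =>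
    mul_nonneg (hpos k).le (hle k)).mp hz
  refine affineMap_eqOn_convexHull (f := g) (g := AffineMap.const ℝ _ y) ?_
  rintro _ ⟨k, rfl⟩
  have := (mul_eq_zero.mp (hz' k (Finset.mem_univ k))).resolve_left (hpos k).ne'
  rw [AffineMap.const_apply]
  linarith

end PyramidsOverSums

/-- A split hull over a copy of `Q` is affinely isomorphic to a pyramid over a direct sum. -/
theorem SplitHull.exists_isPyramidOverSum {ι : Type} [Fintype ι] {q d m : ℕ}
    {v : ι → Fin q → ℝ} {lam : ι → ℝ} {p : Fin q → ℝ} {C P : Set (Fin q → ℝ)}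
    (h : SplitHull v lam p C P) (hm : Fintype.card ι = m + 1) {Q : Set (Fin d → ℝ)}
    (hCQ : AffEquiv C Q) :
    ∃ (i j : ℕ) (R : Set (Fin (j + d + i) → ℝ)),
      0 < j ∧ i + j = m ∧ IsPyramidOverSum i j Q R ∧ AffEquiv P R := by
  classical
  have hQ := hCQ.isPolytope h.polytope
  obtain ⟨φ, ψ, hφ, -, hψφ, -⟩ := hCQ.exists_inverse h.polytope.convex h.polytope.nonempty
  have hc : φ p ∈ intrinsicInterior ℝ Q := by
    refine mem_intrinsicInterior_of_forall hQ.convex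
      (subset_affineSpan ℝ _ (hφ ▸ mem_image_of_mem φ h.center_mem)) ?_
    intro g hg
    rw [← hφ] at hg ⊢
    rintro _ ⟨x, hx, rfl⟩
    exact h.relint (g.comp φ) (fun y hy => hg _ (mem_image_of_mem φ hy)) x hx
  obtain ⟨a, ha⟩ : ∃ a, 0 < lam a := by
    by_contra! hn
    have := Finset.sum_nonpos fun k (_ : k ∈ Finset.univ) => hn k
    linarith [h.sum_eq_one]
  -- The weight of a is below 1, so a second positive weight exists; this is what makes j positive.
  obtain ⟨b, hb, hba⟩ : ∃ b, 0 < lam b ∧ b ≠ a := by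
    by_contra! hn
    have h1 := Finset.add_sum_erase Finset.univ lam (Finset.mem_univ a)
    have h2 : ∑ l ∈ Finset.univ.erase a, lam l ≤ 0 := Finset.sum_nonpos fun l hl =>
      not_lt.mp fun hl' => (Finset.mem_erase.mp hl).1 (hn l hl')
    linarith [h.sum_eq_one, h.lt_one a]
  have hcard : 1 < Fintype.card {k // 0 < lam k} :=
    Fintype.one_lt_card_iff.mpr ⟨⟨b, hb⟩, ⟨a, ha⟩, fun he => hba (congrArg Subtype.val he)⟩
  obtain ⟨j, hj⟩ : ∃ j, Fintype.card {k // 0 < lam k} = j + 1 :=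
    Nat.exists_eq_succ_of_ne_zero (by omega)
  obtain ⟨i, hi⟩ : ∃ i, Fintype.card {k // ¬ 0 < lam k} = i := ⟨_, rfl⟩
  have hij : i + j = m := by
    have := Fintype.card_congr (Equiv.sumCompl fun k => 0 < lam k)
    rw [Fintype.card_sum] at this
    omega
  -- Points of positive weight become the simplex, points of weight zero the apexes.
  let e : Fin (j + 1) ⊕ Fin i ≃ ι :=
    (Equiv.sumCongr (Fintype.equivFinOfCardEq hj).symm (Fintype.equivFinOfCardEq hi).symm).trans
      (Equiv.sumCompl fun k => 0 < lam k)
  have h1 := h.reindex e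
  have hl : lam ∘ e = Sum.elim (fun k => lam (e (Sum.inl k))) 0 := by
    ext k
    rcases k with k | k
    · rfl
    · have := ((Fintype.equivFinOfCardEq hi).symm k).2
      have h0 := h.nonneg ((Fintype.equivFinOfCardEq hi).symm k)
      simp only [Function.comp_apply, Equiv.trans_apply, Equiv.sumCongr_apply, Sum.map_inr,
        Equiv.sumCompl_apply_inr, Sum.elim_inr, Pi.zero_apply, e]
      linarith
  rw [hl] at h1
  have hpos : ∀ k, 0 < lam (e (Sum.inl k)) := fun k => ((Fintype.equivFinOfCardEq hj).symm k).2
  have hsum : ∑ k, lam (e (Sum.inl k)) = 1 := by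
    have := h1.sum_eq_one
    simpa [Fintype.sum_sum_type] using this
  obtain ⟨R, w, A, A', hR, hA, h2⟩ :=
    SpecialSimplex.exists_isPyramidOverSum i (by omega) hQ hpos hsum hc
  refine ⟨i, j, R, by omega, hij, hR, h1.affEquiv (φ := A.comp φ) (ψ := ψ.comp A') h2 ?_ ?_ rfl⟩
  · rw [AffineMap.coe_comp, image_comp, hφ]
  · intro x hx
    simp [hA, hψφ x hx]

/-! ### The face lattice of a split hull -/

section FaceLattices

variable {ι : Type} [Fintype ι] {q : ℕ} {v : ι → Fin q → ℝ} {lam : ι → ℝ} {p : Fin q → ℝ}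
  {C P : Set (Fin q → ℝ)}

/-- The pairs of a set of indices and a face of `C` that describe the faces of a split hull:
the index set contains all indices of positive weight exactly if the face is `C` itself. -/
abbrev FacePairs (lam : ι → ℝ) (C : Set (Fin q → ℝ)) : Type :=
  {x : Set ι × FaceLattice C // (∀ k, 0 < lam k → k ∈ x.1) ↔ x.2.1 = C}

theorem SplitHull.isExposed_inter (h : SplitHull v lam p C P) {F : Set (Fin q → ℝ)}
    (hF : IsExposed ℝ P F) : IsExposed ℝ C (F ∩ C) := by
  obtain ⟨f, hf, rfl⟩ := exists_affineMap_of_isExposed hF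
  have : {x ∈ P | f x = 0} ∩ C = {x ∈ C | f x = 0} := by
    ext x
    exact ⟨fun hx => ⟨hx.2, hx.1.2⟩, fun hx => ⟨⟨h.subset hx.1, hx.2⟩, hx.1⟩⟩
  rw [this]
  exact isExposed_zeros fun x hx => hf x (h.subset hx)

/-- Both sides say that the face contains p, which is a positive combination of these points and a
relative interior point of C. -/
theorem SplitHull.positive_subset_iff (h : SplitHull v lam p C P) {F : Set (Fin q → ℝ)}
    (hF : IsExposed ℝ P F) : (∀ k, 0 < lam k → v k ∈ F) ↔ F ∩ C = C := by
  obtain ⟨f, hf, rfl⟩ := exists_affineMap_of_isExposed hF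
  rw [inter_eq_right]
  constructor
  · intro hk x hx
    exact ⟨h.subset hx, h.eq_zero_of_forall_point hf (fun k hk' => (hk k hk').2) x hx⟩
  · intro hC k hk
    exact ⟨h.point_mem k, h.point_eq_zero hf (hC h.center_mem).2 hk⟩

theorem SplitHull.subset_of_forall (h : SplitHull v lam p C P) {F G : Set (Fin q → ℝ)}
    (hF : IsExposed ℝ P F) (hG : IsExposed ℝ P G) (hv : ∀ k, v k ∈ F → v k ∈ G)
    (hC : F ∩ C ⊆ G) : F ⊆ G := by
  obtain ⟨f, hf, hFe⟩ := exists_affineMap_of_isExposed hF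
  have hG' : Convex ℝ G := hG.convex h.isPolytope.convex
  rw [hFe, h.zeros_eq hf]
  refine convexHull_min ?_ hG'
  rintro x ⟨⟨k, rfl⟩ | hx, h0⟩
  · refine hv k ?_
    rw [hFe]
    exact ⟨h.point_mem k, h0⟩
  · refine hC ⟨?_, hx⟩
    rw [hFe]
    exact ⟨h.subset hx, h0⟩

/-- Every admissible pair comes from a face of the split hull. -/
theorem SplitHull.exists_face (h : SplitHull v lam p C P) {A : Set ι} {G : Set (Fin q → ℝ)}
    (hG : IsExposed ℝ C G) (hAG : (∀ k, 0 < lam k → k ∈ A) ↔ G = C) :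
    ∃ F, IsExposed ℝ P F ∧ {k | v k ∈ F} = A ∧ F ∩ C = G := by
  classical
  -- It suffices to find nonpositive values on the points and on C with zero sets A and G that are
  -- compatible at p.
  obtain ⟨α, g, hg, hle, hα, hαA, hGe⟩ : ∃ (α : ι → ℝ) (g : (Fin q → ℝ) →ᵃ[ℝ] ℝ),
      g p = ∑ k, lam k * α k ∧ (∀ x ∈ C, g x ≤ 0) ∧ (∀ k, α k ≤ 0) ∧ (∀ k, α k = 0 ↔ k ∈ A) ∧
      G = {x ∈ C | g x = 0} := by
    by_cases hGC : G = C
    · have hA := hAG.mpr hGC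
      refine ⟨fun k => if k ∈ A then 0 else -1, AffineMap.const ℝ _ 0, ?_, by simp, ?_, ?_, ?_⟩
      · rw [AffineMap.const_apply, eq_comm]
        refine Finset.sum_eq_zero fun k _ => ?_
        rcases (h.nonneg k).eq_or_lt with h0 | h0
        · rw [← h0, zero_mul]
        · simp [hA k h0]
      · intro k
        dsimp only
        split_ifs <;> norm_num
      · intro k
        simp
      · simp [hGC]
    · obtain ⟨g, hg, hGe⟩ := exists_affineMap_of_isExposed hG
      have hgp : g p < 0 := by
        refine lt_of_le_of_ne (hg p h.center_mem) fun h0 => hGC ?_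
        rw [hGe]
        ext x
        refine ⟨fun hx => hx.1, fun hx => ⟨hx, ?_⟩⟩
        rw [h.relint g (fun y hy => by rw [h0]; exact hg y hy) x hx, h0]
      obtain ⟨a, ha, haA⟩ : ∃ k, 0 < lam k ∧ k ∉ A := by
        have := mt hAG.mp hGC
        push Not at this
        exact this
      -- The negative number g p must be the weighted sum of the α k; it is spread evenly over the
      -- indices outside A, whose total weight τ is positive.
      set τ := ∑ k, if k ∈ A then 0 else lam k with hτ
      have hτpos : 0 < τ := by
        refine Finset.sum_pos' (fun k _ => ?_) ⟨a, Finset.mem_univ a, by simp [haA, ha]⟩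
        split_ifs
        exacts [le_rfl, h.nonneg k]
      refine ⟨fun k => if k ∈ A then 0 else g p / τ, g, ?_, hg, ?_, ?_, hGe⟩
      · have : ∀ k, lam k * (if k ∈ A then 0 else g p / τ) =
            (if k ∈ A then 0 else lam k) * (g p / τ) := by
          intro k
          split_ifs <;> simp
        simp_rw [this, ← Finset.sum_mul, ← hτ]
        field_simp
      · intro k
        dsimp only
        split_ifs
        exacts [le_rfl, (div_neg_of_neg_of_pos hgp hτpos).le]
      · intro k
        simp [hgp.ne, hτpos.ne']
  obtain ⟨f, hf, hfC⟩ := h.extend α g hg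
  have hfP : ∀ x ∈ P, f x ≤ 0 := h.le_of_forall (fun k => by rw [hf]; exact hα k)
    fun x hx => by rw [hfC x hx]; exact hle x hx
  refine ⟨{x ∈ P | f x = 0}, isExposed_zeros hfP, ?_, ?_⟩
  · ext k
    simp only [mem_ofPred_eq, h.point_mem k, true_and, hf, hαA]
  · rw [hGe]
    ext x
    constructor
    · rintro ⟨⟨-, h0⟩, hx⟩
      exact ⟨hx, by rw [← hfC x hx, h0]⟩
    · rintro ⟨hx, h0⟩
      exact ⟨⟨h.subset hx, by rw [hfC x hx, h0]⟩, hx⟩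

/-- The face lattice of a split hull. -/
theorem SplitHull.nonempty_faceLattice_orderIso (h : SplitHull v lam p C P) :
    Nonempty (FaceLattice P ≃o FacePairs lam C) := by
  let toPair : FaceLattice P → FacePairs lam C := fun F =>
    ⟨({k | v k ∈ F.1}, ⟨F.1 ∩ C, h.isExposed_inter F.2⟩), h.positive_subset_iff F.2⟩
  have hle : ∀ F G, toPair F ≤ toPair G ↔ F ≤ G := by
    intro F G
    constructor
    · rintro ⟨h1, h2⟩
      exact h.subset_of_forall F.2 G.2 (fun k hk => h1 hk) fun x hx => (h2 hx).1
    · intro hFG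
      exact ⟨fun k hk => hFG hk, fun x hx => ⟨hFG hx.1, hx.2⟩⟩
  refine ⟨RelIso.ofSurjective (OrderEmbedding.ofMapLEIff toPair hle) ?_⟩
  rintro ⟨⟨A, G⟩, hAG⟩
  obtain ⟨F, hF, hA, hG⟩ := h.exists_face G.2 hAG
  exact ⟨⟨F, hF⟩, Subtype.ext (Prod.ext hA (Subtype.ext hG))⟩

theorem FaceLattice.eq_self_iff {C : Set (Fin q → ℝ)} (G : FaceLattice C) :
    G.1 = C ↔ ∀ H : FaceLattice C, H ≤ G := by
  constructor
  · intro hG H x hx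
    rw [hG]
    exact H.2.subset hx
  · intro hG
    exact Subset.antisymm G.2.subset (hG ⟨C, IsExposed.refl C⟩)

theorem orderIso_eq_self_iff {r : ℕ} {D : Set (Fin r → ℝ)} (E : FaceLattice C ≃o FaceLattice D)
    (G : FaceLattice C) : (E G).1 = D ↔ G.1 = C := by
  rw [FaceLattice.eq_self_iff, FaceLattice.eq_self_iff, E.surjective.forall]
  simp

/-- Split hulls over combinatorially equivalent polytopes, with weights of equal support, are
combinatorially equivalent. -/
theorem SplitHull.combEquiv (h : SplitHull v lam p C P) {r : ℕ} {w : ι → Fin r → ℝ}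
    {lam' : ι → ℝ} {p' : Fin r → ℝ} {D R : Set (Fin r → ℝ)} (h' : SplitHull w lam' p' D R)
    (hlam : ∀ k, 0 < lam k ↔ 0 < lam' k) (hCD : CombEquiv C D) : CombEquiv P R := by
  obtain ⟨E⟩ := hCD
  obtain ⟨e⟩ := h.nonempty_faceLattice_orderIso
  obtain ⟨e'⟩ := h'.nonempty_faceLattice_orderIso
  let mid : FacePairs lam C ≃o FacePairs lam' D :=
    { toFun := fun x => ⟨(x.1.1, E x.1.2), by
        rw [orderIso_eq_self_iff E, ← x.2]
        simp only [hlam]⟩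
      invFun := fun x => ⟨(x.1.1, E.symm x.1.2), by
        rw [orderIso_eq_self_iff E.symm, ← x.2]
        simp only [hlam]⟩
      left_inv := fun x => Subtype.ext (Prod.ext rfl (E.symm_apply_apply _))
      right_inv := fun x => Subtype.ext (Prod.ext rfl (E.apply_symm_apply _))
      map_rel_iff' := fun {x y} => and_congr Iff.rfl E.le_iff_le }
  exact ⟨(e.trans mid).trans e'.symm⟩

end FaceLattices

/-! ### Counting faces to recover the number of apexes -/

section Counting

variable {q : ℕ} {C : Set (Fin q → ℝ)}

theorem IsPolytope.finite_faceLattice (hC : IsPolytope C) : Finite (FaceLattice C) := by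
  obtain ⟨t, -, rfl⟩ := hC
  let φ : FaceLattice (convexHull ℝ (t : Set (Fin q → ℝ))) → Set t :=
    fun F => {x | (x : Fin q → ℝ) ∈ F.1}
  refine Finite.of_injective φ ?_
  have key : ∀ F : FaceLattice (convexHull ℝ (t : Set (Fin q → ℝ))),
      F.1 = convexHull ℝ {x ∈ (t : Set (Fin q → ℝ)) | x ∈ F.1} := by
    intro F
    obtain ⟨f, hf, hFe⟩ := exists_affineMap_of_isExposed F.2
    conv_lhs => rw [hFe, zeros_convexHull f fun x hx => hf x (subset_convexHull ℝ _ hx)]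
    congr 1
    ext x
    rw [hFe]
    exact ⟨fun hx => ⟨hx.1, subset_convexHull ℝ _ hx.1, hx.2⟩, fun hx => ⟨hx.1, hx.2.2⟩⟩
  intro F G hFG
  apply Subtype.ext
  rw [key F, key G]
  congr 1
  ext x
  refine and_congr_right fun hx => ?_
  have := Set.ext_iff.mp hFG ⟨x, hx⟩
  exact this

/-- The empty face and the maximal face of a nonconstant functional. With only one proper face, the
face count would not depend on i. -/
theorem IsPolytope.two_le_card_proper_faces (hC : IsPolytope C) (hd : 1 ≤ dim C) :
    2 ≤ Nat.card {G : FaceLattice C // G.1 ≠ C} := by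
  have := hC.finite_faceLattice
  obtain ⟨l, x, hx, y, hy, hxy⟩ : ∃ l : (Fin q → ℝ) →ₗ[ℝ] ℝ, ∃ x ∈ C, ∃ y ∈ C, l x ≠ l y := by
    by_contra! hn
    have h1 : vectorSpan ℝ C ≤ vectorSpan ℝ (∅ : Set (Fin q → ℝ)) :=
      vectorSpan_le_vectorSpan_of_forall fun l _ => hn l
    rw [vectorSpan_empty, le_bot_iff] at h1
    rw [dim, h1, finrank_bot] at hd
    omega
  obtain ⟨a, ha, hmax⟩ := hC.exists_isMaxOn l.toAffineMap
  let f : (Fin q → ℝ) →ᵃ[ℝ] ℝ := l.toAffineMap - AffineMap.const ℝ _ (l a)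
  have hfe : ∀ x, f x = l x - l a := fun x => by simp [f]
  have hf : ∀ x ∈ C, f x ≤ 0 := fun x hx => by
    rw [hfe]
    exact sub_nonpos.mpr (hmax x hx)
  have hne : {x ∈ C | f x = 0} ≠ C := by
    intro he
    rw [← he] at hx hy
    have h1 := hx.2
    have h2 := hy.2
    rw [hfe] at h1 h2
    exact hxy (by linarith)
  have haF : a ∈ {x ∈ C | f x = 0} := ⟨ha, by rw [hfe, sub_self]⟩
  have hemp : (∅ : Set (Fin q → ℝ)) ≠ C := fun he => by
    rw [← he] at ha
    exact ha
  have hnt : Nontrivial {G : FaceLattice C // G.1 ≠ C} :=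
    ⟨⟨⟨∅, isExposed_empty⟩, hemp⟩,
      ⟨⟨_, isExposed_zeros hf⟩, hne⟩, fun he => by
        have h1 : (∅ : Set (Fin q → ℝ)) = {x ∈ C | f x = 0} := congrArg (fun G => G.1.1) he
        rw [← h1] at haF
        exact haF⟩
  exact Finite.one_lt_card_iff_nontrivial.mpr hnt

theorem card_supersets (j i : ℕ) {lam : Fin (j + 1) → ℝ} (hpos : ∀ k, 0 < lam k) :
    Nat.card {A : Set (Fin (j + 1) ⊕ Fin i) //
      ∀ k, 0 < (Sum.elim lam 0 : Fin (j + 1) ⊕ Fin i → ℝ) k → k ∈ A} = 2 ^ i := by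
  let e : {A : Set (Fin (j + 1) ⊕ Fin i) //
      ∀ k, 0 < (Sum.elim lam 0 : Fin (j + 1) ⊕ Fin i → ℝ) k → k ∈ A} ≃ Set (Fin i) :=
    { toFun := fun A => {x | Sum.inr x ∈ A.1}
      invFun := fun B => ⟨range Sum.inl ∪ Sum.inr '' B, by
        rintro (k | k) hk
        · exact Or.inl ⟨k, rfl⟩
        · simp at hk⟩
      left_inv := by
        rintro ⟨A, hA⟩
        apply Subtype.ext
        ext k
        rcases k with k | k
        · simp [hA (Sum.inl k) (hpos k)]
        · simp
      right_inv := by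
        intro B
        ext x
        simp }
  rw [Nat.card_congr e, Nat.card_eq_fintype_card, Fintype.card_set, Fintype.card_fin]

/-- The number of faces of a split hull. -/
theorem card_facePairs (hC : IsPolytope C) {j i : ℕ} {lam : Fin (j + 1) → ℝ}
    (hpos : ∀ k, 0 < lam k) :
    Nat.card (FacePairs (Sum.elim lam 0 : Fin (j + 1) ⊕ Fin i → ℝ) C) +
        2 ^ i * Nat.card {G : FaceLattice C // G.1 ≠ C} =
      2 ^ i + 2 ^ (i + j + 1) * Nat.card {G : FaceLattice C // G.1 ≠ C} := by
  classical
  have := hC.finite_faceLattice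
  let mu : Fin (j + 1) ⊕ Fin i → ℝ := Sum.elim lam 0
  let T : Set (Fin (j + 1) ⊕ Fin i) → Prop := fun A => ∀ k, 0 < mu k → k ∈ A
  -- An index set containing all positive indices forces the face C; any other index set may be
  -- paired with every proper face.
  let e : FacePairs mu C ≃ {A // T A} ⊕ {A // ¬ T A} × {G : FaceLattice C // G.1 ≠ C} :=
    { toFun := fun x => if hx : T x.1.1 then Sum.inl ⟨x.1.1, hx⟩ else
        Sum.inr (⟨x.1.1, hx⟩, ⟨x.1.2, fun h => hx (x.2.mpr h)⟩)
      invFun := fun y => y.elim (fun A => ⟨(A.1, ⟨C, IsExposed.refl C⟩), iff_of_true A.2 rfl⟩)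
        fun z => ⟨(z.1.1, z.2.1), iff_of_false z.1.2 z.2.2⟩
      left_inv := by
        rintro ⟨⟨A, G⟩, hx⟩
        by_cases hA : T A
        · have hG : G.1 = C := hx.mp hA
          simp only [hA, dite_true, Sum.elim_inl]
          exact Subtype.ext (Prod.ext rfl (Subtype.ext hG.symm))
        · simp only [hA, dite_false, Sum.elim_inr]
      right_inv := by
        rintro (A | ⟨A, G⟩)
        · simp [A.2]
        · simp [A.2] }
  have h1 : Nat.card {A // T A} = 2 ^ i := card_supersets j i hpos
  have h2 : Nat.card {A // T A} + Nat.card {A // ¬ T A} = 2 ^ (i + j + 1) := by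
    rw [← Nat.card_sum, Nat.card_congr (Equiv.sumCompl T), Nat.card_eq_fintype_card,
      Fintype.card_set, Fintype.card_sum, Fintype.card_fin, Fintype.card_fin]
    congr 1
    omega
  have h3 : Nat.card (FacePairs mu C) = Nat.card {A // T A} +
      Nat.card {A // ¬ T A} * Nat.card {G : FaceLattice C // G.1 ≠ C} := by
    rw [Nat.card_congr e, Nat.card_sum, Nat.card_prod]
  change Nat.card (FacePairs mu C) + _ = _
  rw [h3, ← h2, h1]
  ring

theorem card_proper_faces_congr {r : ℕ} {D : Set (Fin r → ℝ)} (h : CombEquiv C D) :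
    Nat.card {G : FaceLattice C // G.1 ≠ C} = Nat.card {G : FaceLattice D // G.1 ≠ D} := by
  obtain ⟨E⟩ := h
  exact Nat.card_congr (E.toEquiv.subtypeEquiv fun G => (orderIso_eq_self_iff E G).not.symm)

/-- The support of the weights of a split hull is determined by its combinatorial type. -/
theorem SplitHull.eq_of_combEquiv {r d : ℕ} {Q : Set (Fin d → ℝ)} (hd : 1 ≤ dim Q)
    {D P : Set (Fin q → ℝ)} {D' P' : Set (Fin r → ℝ)} {i j i' j' : ℕ}
    {lam : Fin (j + 1) → ℝ} (hpos : ∀ k, 0 < lam k) {lam' : Fin (j' + 1) → ℝ}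
    (hpos' : ∀ k, 0 < lam' k) {v : Fin (j + 1) ⊕ Fin i → Fin q → ℝ} {p : Fin q → ℝ}
    {v' : Fin (j' + 1) ⊕ Fin i' → Fin r → ℝ} {p' : Fin r → ℝ}
    (h : SplitHull v (Sum.elim lam 0) p D P) (h' : SplitHull v' (Sum.elim lam' 0) p' D' P')
    (hQ : IsPolytope Q) (hD : CombEquiv D Q) (hD' : CombEquiv D' Q) (hij : i + j = i' + j')
    (hPP : CombEquiv P P') : i = i' := by
  obtain ⟨e⟩ := h.nonempty_faceLattice_orderIso
  obtain ⟨e'⟩ := h'.nonempty_faceLattice_orderIso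
  obtain ⟨E⟩ := hPP
  have h1 := card_facePairs h.polytope (i := i) hpos
  have h2 := card_facePairs h'.polytope (i := i') hpos'
  rw [← Nat.card_congr e.toEquiv, card_proper_faces_congr hD] at h1
  rw [← Nat.card_congr e'.toEquiv, card_proper_faces_congr hD', ← hij,
    ← Nat.card_congr E.toEquiv] at h2
  have hM := hQ.two_le_card_proper_faces hd
  obtain ⟨M, hM'⟩ := Nat.exists_eq_add_of_le hM
  rw [hM'] at h1 h2
  -- With N = 2 + M proper faces, both counts satisfy: faces + 2^i (N - 1) = 2^(m+1) N, where m = i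
  -- + j.
  have h3 : 2 ^ i * (1 + M) = 2 ^ i' * (1 + M) := by
    have ha : 2 ^ i * (2 + M) = 2 ^ i * (1 + M) + 2 ^ i := by ring
    have hb : 2 ^ i' * (2 + M) = 2 ^ i' * (1 + M) + 2 ^ i' := by ring
    omega
  exact Nat.pow_right_injective le_rfl (Nat.eq_of_mul_eq_mul_right (by omega) h3)

end Counting

/-- Every polytope is affinely isomorphic to a full-dimensional one. -/
theorem exists_affEquiv_fullDim {q n : ℕ} {P : Set (Fin q → ℝ)} (hn : dim P = n) :
    ∃ P' : Set (Fin n → ℝ), AffEquiv P P' := by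
  subst hn
  let e := (Module.finBasis ℝ (vectorSpan ℝ P)).equivFun
  obtain ⟨L, hL⟩ := LinearMap.exists_extend e.toLinearMap
  refine ⟨L.toAffineMap '' P, L.toAffineMap, mapsTo_image _ _, ?_, surjOn_image _ _⟩
  intro x hx y hy hxy
  have h1 : e ⟨x - y, vsub_mem_vectorSpan ℝ hx hy⟩ = L (x - y) :=
    (LinearMap.congr_fun hL ⟨x - y, vsub_mem_vectorSpan ℝ hx hy⟩).symm
  have hL' : L x = L y := hxy
  rw [map_sub, hL', sub_self, LinearEquiv.map_eq_zero_iff] at h1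
  exact sub_eq_zero.mp (congrArg Subtype.val h1)

/-! ### Classification of meek polytopes -/

section Classification

variable {q d n m : ℕ} {P : Set (Fin q → ℝ)} {Q : Set (Fin d → ℝ)}

theorem IsBasisPolytope.isPolytope {e : ℕ} {s : Finset (Fin q → ℝ)} {B : Set (Fin e → ℝ)}
    (h : IsBasisPolytope P s B) (hP : IsPolytope P) : IsPolytope B := by
  obtain ⟨π, -, -, rfl⟩ := h
  exact hP.image π.toAffineMap

theorem IsSpecialSimplex.exists_isPyramidOverSum {s : Finset (Fin q → ℝ)}
    (hs : IsSpecialSimplex m P s) (hP : IsPolytope P) (hd : m < dim P) (hmeek : IsMeek P s) {e : ℕ}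
    {B : Set (Fin e → ℝ)} (hB : IsBasisPolytope P s B) (hBQ : AffEquiv B Q) :
    dim Q + m = dim P ∧ ∃ (i j : ℕ) (R : Set (Fin (j + d + i) → ℝ)),
      0 < j ∧ i + j = m ∧ IsPyramidOverSum i j Q R ∧ AffEquiv P R := by
  classical
  obtain ⟨lam, p, C, h⟩ := hs.exists_splitHull hP hd hmeek
  have hcard : Fintype.card s = m + 1 := by rw [Fintype.card_coe]; exact hs.1
  have himg : Finset.univ.image (fun k : s => (k : Fin q → ℝ)) = s := by simp
  rw [← himg] at hB
  have hCQ := (h.affEquiv_basisPolytope hB).trans hBQ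
  refine ⟨?_, h.exists_isPyramidOverSum hcard hCQ⟩
  rw [← hCQ.dim_eq h.polytope.convex, h.dim_eq hcard]

theorem IsPyramidOverSum.exists_isSpecialSimplex {i j : ℕ} {R : Set (Fin (j + d + i) → ℝ)}
    (h : IsPyramidOverSum i j Q R) (hj : 0 < j) (hij : i + j = m) (hQ : IsPolytope Q)
    (hP : IsPolytope P) (hPR : AffEquiv P R) :
    ∃ s, IsSpecialSimplex m P s ∧ IsMeek P s ∧
      ∃ (e : ℕ) (B : Set (Fin e → ℝ)), IsBasisPolytope P s B ∧ AffEquiv B Q := by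
  classical
  obtain ⟨lam, c, v, A, A', -, hA, hR⟩ := h.exists_splitHull hj hQ
  obtain ⟨f', f, -, hfR, -, hf'⟩ := hPR.exists_inverse hP.convex hP.nonempty
  have hS := hR.map hf'
  rw [hfR] at hS
  refine ⟨_, hS.isSpecialSimplex (by simp; omega), hS.isMeek, ?_⟩
  obtain ⟨e, B, hB⟩ := exists_isBasisPolytope P (Finset.univ.image (f ∘ v))
  refine ⟨e, B, hB, ?_⟩
  have hQC : AffEquiv Q (f '' (A '' Q)) := by
    refine AffEquiv.of_inverse (f' := A' ∘ f') (f.comp A) ?_ ?_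
    · rw [AffineMap.coe_comp, image_comp]
    · intro x hx
      simp [hf' _ (hR.subset (mem_image_of_mem A hx)), hA]
  exact (hQC.trans (hS.affEquiv_basisPolytope hB)).symm hQ.convex hQ.nonempty

theorem IsPyramidOverSum.isPolytope_and_dim {i j : ℕ} {R : Set (Fin (j + d + i) → ℝ)}
    (h : IsPyramidOverSum i j Q R) (hj : 0 < j) (hQ : IsPolytope Q) :
    IsPolytope R ∧ dim R = dim Q + (i + j) := by
  obtain ⟨lam, c, v, A, A', -, hA, hR⟩ := h.exists_splitHull hj hQ
  have hQC : AffEquiv Q (A '' Q) := AffEquiv.of_inverse A rfl fun x _ => hA x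
  refine ⟨hR.isPolytope, ?_⟩
  rw [hQC.dim_eq hQ.convex]
  exact hR.dim_eq (by simp; omega)

theorem IsPyramidOverSum.isMeekOver {i j : ℕ} {R : Set (Fin (j + d + i) → ℝ)}
    (h : IsPyramidOverSum i j Q R) (hj : 0 < j) (hij : i + j = m) (hQ : IsPolytope Q)
    (hP : IsPolytope P) (hPR : AffEquiv P R) (hd : dim P = n) : IsMeekOver n m Q P := by
  obtain ⟨s, hs, hm, e, B, hB, hBQ⟩ := h.exists_isSpecialSimplex hj hij hQ hP hPR
  have hBp := hB.isPolytope hP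
  exact ⟨hP, hd, s, hs, hm, e, B, hB, hBQ.combEquiv hBp.convex hBp.nonempty⟩

/-- The combinatorial type of an iterated pyramid over a direct sum with a simplex depends only
on the combinatorial type of the other summand. -/
theorem IsPyramidOverSum.combEquiv {i j e : ℕ} {R : Set (Fin (j + d + i) → ℝ)}
    (h : IsPyramidOverSum i j Q R) (hj : 0 < j) (hQ : IsPolytope Q) {B : Set (Fin e → ℝ)}
    {R' : Set (Fin (j + e + i) → ℝ)} (h' : IsPyramidOverSum i j B R') (hB : IsPolytope B)
    (hQB : CombEquiv Q B) : CombEquiv R R' := by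
  obtain ⟨lam, c, v, A, A', hpos, hA, hR⟩ := h.exists_splitHull hj hQ
  obtain ⟨lam', c', v', A₁, A₁', hpos', hA₁, hR'⟩ := h'.exists_splitHull hj hB
  have h1 : AffEquiv Q (A '' Q) := AffEquiv.of_inverse A rfl fun x _ => hA x
  have h2 : AffEquiv B (A₁ '' B) := AffEquiv.of_inverse A₁ rfl fun x _ => hA₁ x
  refine hR.combEquiv hR' ?_ (((h1.combEquiv hQ.convex hQ.nonempty).symm.trans hQB).trans
    (h2.combEquiv hB.convex hB.nonempty))
  rintro (k | k)
  · simp [hpos, hpos']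
  · simp

theorem exists_pyramidOverSum (i : ℕ) {j : ℕ} (hj : 0 < j) (hQ : IsPolytope Q) :
    ∃ R : Set (Fin (j + d + i) → ℝ), IsPyramidOverSum i j Q R := by
  obtain ⟨c, hc⟩ := hQ.nonempty.intrinsicInterior hQ.convex
  obtain ⟨R, -, -, -, hR, -⟩ := exists_isPyramidOverSum i hj hQ
    (lam := fun _ : Fin (j + 1) => ((j : ℝ) + 1)⁻¹) (fun _ => by positivity)
    (by
      simp only [Finset.sum_const, Finset.card_univ, Fintype.card_fin, nsmul_eq_mul]
      push_cast
      exact mul_inv_cancel₀ (by positivity)) hc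
  exact ⟨R, hR⟩

/-- The affine classification yields a pyramid over a sum with the actual basis polytope B; B can
then be exchanged for the combinatorially equivalent Q. -/
theorem IsMeekOver.exists_combEquiv (h : IsMeekOver n m Q P) (hmn : m < n) (hQ : IsPolytope Q) :
    ∃ (i j : ℕ) (R : Set (Fin (j + d + i) → ℝ)),
      0 < j ∧ i + j = m ∧ IsPyramidOverSum i j Q R ∧ CombEquiv P R := by
  obtain ⟨hP, hd, s, hs, hm, e, B, hB, hBQ⟩ := h
  have hBp := hB.isPolytope hP
  obtain ⟨-, i, j, R, hj, hij, hR, hPR⟩ :=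
    hs.exists_isPyramidOverSum hP (by omega) hm hB (AffEquiv.refl B)
  obtain ⟨R', hR'⟩ := exists_pyramidOverSum i hj hQ
  exact ⟨i, j, R', hj, hij, hR', (hPR.combEquiv hP.convex hP.nonempty).trans
    (hR.combEquiv hj hBp hR' hQ hBQ)⟩

theorem IsPyramidOverSum.eq_of_combEquiv {i j i' j' : ℕ} {R : Set (Fin (j + d + i) → ℝ)}
    {R' : Set (Fin (j' + d + i') → ℝ)} (h : IsPyramidOverSum i j Q R) (hj : 0 < j)
    (h' : IsPyramidOverSum i' j' Q R') (hj' : 0 < j') (hQ : IsPolytope Q) (hd : 1 ≤ dim Q)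
    (hij : i + j = i' + j') (hRR : CombEquiv R R') : i = i' := by
  obtain ⟨lam, c, v, A, A', hpos, hA, hR⟩ := h.exists_splitHull hj hQ
  obtain ⟨lam', c', v', A₁, A₁', hpos', hA₁, hR'⟩ := h'.exists_splitHull hj' hQ
  have h1 : AffEquiv Q (A '' Q) := AffEquiv.of_inverse A rfl fun x _ => hA x
  have h2 : AffEquiv Q (A₁ '' Q) := AffEquiv.of_inverse A₁ rfl fun x _ => hA₁ x
  exact SplitHull.eq_of_combEquiv hd hpos hpos' hR hR' hQ (h1.combEquiv hQ.convex hQ.nonempty).symm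
    (h2.combEquiv hQ.convex hQ.nonempty).symm hij hRR

end Classification

end SpecialSimplex

/-! ### The main theorem -/

open SpecialSimplex in
theorem mainTheorem1 (n m : ℕ) (hm : 1 ≤ m) (hmn : m < n) :
    -- classification of the meek polytopes themselves
    (∀ (q : ℕ) (P : Set (Fin q → ℝ)), IsPolytope P → dim P = n →
      ((∃ s, IsSpecialSimplex m P s ∧ IsMeek P s) ↔
        ∃ (d : ℕ) (Q : Set (Fin d → ℝ)), IsPolytope Q ∧ dim Q + m = n ∧
          ∃ (i j : ℕ) (R : Set (Fin (j + d + i) → ℝ)),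
            0 < j ∧ i + j = m ∧ IsPyramidOverSum i j Q R ∧ AffEquiv P R)) ∧
    -- the polytope `Q` here is precisely the basis polytope
    (∀ (q : ℕ) (P : Set (Fin q → ℝ)), IsPolytope P → dim P = n →
      ∀ (d : ℕ) (Q : Set (Fin d → ℝ)), IsPolytope Q →
        ((∃ s, IsSpecialSimplex m P s ∧ IsMeek P s ∧
            ∃ (e : ℕ) (B : Set (Fin e → ℝ)), IsBasisPolytope P s B ∧ AffEquiv B Q) ↔
          dim Q + m = n ∧ ∃ (i j : ℕ) (R : Set (Fin (j + d + i) → ℝ)),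
            0 < j ∧ i + j = m ∧ IsPyramidOverSum i j Q R ∧ AffEquiv P R)) ∧
    -- combinatorial classification for a given basis polytope
    (∀ (d : ℕ) (Q : Set (Fin d → ℝ)), IsPolytope Q → dim Q + m = n →
      ∀ (q : ℕ) (P : Set (Fin q → ℝ)), IsPolytope P → dim P = n →
        ((∃ (q' : ℕ) (P' : Set (Fin q' → ℝ)), IsMeekOver n m Q P' ∧ CombEquiv P P') ↔
          ∃ (i j : ℕ) (R : Set (Fin (j + d + i) → ℝ)),
            0 < j ∧ i + j = m ∧ IsPyramidOverSum i j Q R ∧ CombEquiv P R)) ∧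
    -- for a given basis polytope there are exactly `m` combinatorial types
    (∀ (d : ℕ) (Q : Set (Fin d → ℝ)), IsPolytope Q → dim Q + m = n →
      ∃ T : Fin m → Set (Fin n → ℝ),
        (∀ k, IsMeekOver n m Q (T k)) ∧
        (∀ k l, CombEquiv (T k) (T l) → k = l) ∧
        ∀ (q : ℕ) (P : Set (Fin q → ℝ)), IsMeekOver n m Q P → ∃ k, CombEquiv P (T k)) := by
  refine ⟨?_, ?_, ?_, ?_⟩
  · intro q P hP hd
    constructor
    · rintro ⟨s, hs, hmeek⟩
      obtain ⟨d, Q, hQ, -⟩ := id hmeek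
      obtain ⟨h1, h2⟩ := hs.exists_isPyramidOverSum hP (by omega) hmeek hQ (AffEquiv.refl Q)
      exact ⟨d, Q, hQ.isPolytope hP, by omega, h2⟩
    · rintro ⟨d, Q, hQ, -, i, j, R, hj, hij, hR, hPR⟩
      obtain ⟨s, hs, hmeek, -⟩ := hR.exists_isSpecialSimplex hj hij hQ hP hPR
      exact ⟨s, hs, hmeek⟩
  · intro q P hP hd d Q hQ
    constructor
    · rintro ⟨s, hs, hmeek, e, B, hB, hBQ⟩
      have := hs.exists_isPyramidOverSum hP (by omega) hmeek hB hBQ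
      rwa [hd] at this
    · rintro ⟨-, i, j, R, hj, hij, hR, hPR⟩
      exact hR.exists_isSpecialSimplex hj hij hQ hP hPR
  · intro d Q hQ hdQ q P hP hd
    constructor
    · rintro ⟨q', P', hP', hPP'⟩
      obtain ⟨i, j, R, hj, hij, hR, hPR⟩ := hP'.exists_combEquiv hmn hQ
      exact ⟨i, j, R, hj, hij, hR, hPP'.trans hPR⟩
    · rintro ⟨i, j, R, hj, hij, hR, hPR⟩
      obtain ⟨hRp, hRd⟩ := hR.isPolytope_and_dim hj hQ
      exact ⟨_, R, hR.isMeekOver hj hij hQ hRp (AffEquiv.refl R) (by omega), hPR⟩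
  · intro d Q hQ hdQ
    -- The k-th type has j = k + 1 and i = m - (k + 1), so j runs through 1, …, m. The model R lives
    -- in dimension j + d + i, which may exceed n when Q is not full-dimensional, hence the
    -- full-dimensional copy T.
    have hex : ∀ k : Fin m, ∃ (R : Set (Fin ((k + 1 : ℕ) + d + (m - (k + 1))) → ℝ))
        (T : Set (Fin n → ℝ)), IsPyramidOverSum (m - (k + 1)) (k + 1) Q R ∧ IsPolytope R ∧
        AffEquiv R T ∧ dim R = n := by
      intro k
      obtain ⟨R, hR⟩ := exists_pyramidOverSum (m - (k + 1)) (Nat.succ_pos (k : ℕ)) hQ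
      obtain ⟨hRp, hRd⟩ := hR.isPolytope_and_dim (Nat.succ_pos _) hQ
      have hRn : dim R = n := by
        have := k.2
        omega
      obtain ⟨T, hT⟩ := exists_affEquiv_fullDim hRn
      exact ⟨R, T, hR, hRp, hT, hRn⟩
    choose R T hR hRp hRT hRn using hex
    have hcomb : ∀ k, CombEquiv (R k) (T k) := fun k =>
      (hRT k).combEquiv (hRp k).convex (hRp k).nonempty
    refine ⟨T, fun k => ?_, fun k l hkl => ?_, fun q P hP => ?_⟩
    · refine (hR k).isMeekOver (Nat.succ_pos _) ?_ hQ ((hRT k).isPolytope (hRp k))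
        ((hRT k).symm (hRp k).convex (hRp k).nonempty) ?_
      · have := k.2
        omega
      · rw [← (hRT k).dim_eq (hRp k).convex, hRn]
    · have := (hR k).eq_of_combEquiv (Nat.succ_pos _) (hR l) (Nat.succ_pos _) hQ (by omega)
        (by have := k.2; have := l.2; omega) (((hcomb k).trans hkl).trans (hcomb l).symm)
      apply Fin.ext
      have := k.2
      have := l.2
      omega
    · obtain ⟨i, j, R', hj, hij, hR', hPR'⟩ := hP.exists_combEquiv hmn hQ
      obtain ⟨k, rfl⟩ : ∃ k, j = k + 1 := Nat.exists_eq_succ_of_ne_zero hj.ne'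
      obtain rfl : i = m - (k + 1) := by omega
      have hid : CombEquiv Q Q := ⟨OrderIso.refl _⟩
      exact ⟨⟨k, by omega⟩, hPR'.trans
        ((hR'.combEquiv hj hQ (hR ⟨k, by omega⟩) hQ hid).trans (hcomb ⟨k, by omega⟩))⟩
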